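/- Let $a,b$ be non-zero integers and let the circle $S^1=\{t\in\mathbb{C}: |t|=1\}$ act on the unit sphere $S^6\subset\mathbb{C}^3\times\mathbb{R}=\mathbb{R}^7$ by the standard almost complex action $$t\cdot(z_1,z_2,z_3,x)=(t^{-a}z_1,\;t^{b}z_2,\;t^{a+b}z_3,\;x),$$ which comes from a subcircle of a maximal torus of $G_2$. Let $O=S^1\cdot p$ be a free orbit (the stabiliser of $p$ is trivial). A (normal) framing of an embedded circle $C\subset S^6$ consists of five continuous sections of $TS^6|_C$ whose classes form a basis of the normal space $T_qS^6/T_qC$ at every $q\in C$; framings of $C$ are homotopic if they are joined by a continuous path of framings of $C$. A framing of $O$ is equivariant if it has the form $t\cdot p\mapsto (t_*v_1,\dots,t_*v_5)$ with $v_1,\dots,v_5\in T_pS^6$. The trivial framing of the coordinate circle $S_0=\{(u,v,0,0,0,0,0): u^2+v^2=1\}$ is the constant framing $e_3,\dots,e_7$. A framing of an embedded circle in $S^6$ is trivial if, up to homotopy of framings, it is carried to the trivial framing of $S_0$ by a smooth ambient isotopy of $S^6$ (circles are not oriented), and non-trivial otherwise. Then $O$ has an equivariant framing, and every equivariant framing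 of $O$ is non-trivial. -/

import Mathlib

open scoped Manifold ContDiff

noncomputable section

namespace CircleFraming

section General

variable {m k : ℕ} {M : Type*} [TopologicalSpace M] [ChartedSpace (EuclideanSpace ℝ (Fin m)) M]

/-- The tangent line at `c z` of a smoothly embedded circle `c : Circle → M`. -/
def tangentLine (c : Circle → M) (z : Circle) : Submodule ℝ (TangentSpace (𝓡 m) (c z)) :=
  LinearMap.range (mfderiv (𝓡 1) (𝓡 m) c z).toLinearMap

/-- The fibre at `c z` of the normal bundle `TM|_C / TC` of the circle `C = c(S¹)`. -/
abbrev NormalSpace (c : Circle → M) (z : Circle) : Type :=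
  TangentSpace (𝓡 m) (c z) ⧸ tangentLine c z

/-- A `k`-tuple of (not necessarily continuous) tangent vector fields of `M` along `c`. -/
abbrev FieldsAlong (m k : ℕ) {M : Type*} [TopologicalSpace M]
    [ChartedSpace (EuclideanSpace ℝ (Fin m)) M] (c : Circle → M) : Type :=
  (z : Circle) → Fin k → TangentSpace (𝓡 m) (c z)

variable [IsManifold (𝓡 m) ∞ M]

/-- `F` is (a representative of) a framing of the normal bundle of the circle `c`: it consists of
continuous vector fields along `c` whose classes form a basis of the normal space at every point
of the circle. -/
structure IsNormalFraming (c : Circle → M) (F : FieldsAlong m k c) : Prop where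
  continuous : ∀ i, Continuous fun z : Circle => (⟨c z, F z i⟩ : TangentBundle (𝓡 m) M)
  linearIndependent : ∀ z, LinearIndependent ℝ fun i => (tangentLine c z).mkQ (F z i)
  span_eq_top : ∀ z, Submodule.span ℝ (Set.range fun i => (tangentLine c z).mkQ (F z i)) = ⊤

/-- Homotopy of normal framings of a fixed circle, through normal framings. -/
def FramingHomotopic (c : Circle → M) (F G : FieldsAlong m k c) : Prop :=
  ∃ Γ : unitInterval → FieldsAlong m k c,
    (∀ i, Continuous fun q : unitInterval × Circle =>
      (⟨c q.2, Γ q.1 q.2 i⟩ : TangentBundle (𝓡 m) M)) ∧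
    (∀ s, IsNormalFraming c (Γ s)) ∧ Γ 0 = F ∧ Γ 1 = G

/-- A smooth ambient isotopy of `M`: a smooth one-parameter family of diffeomorphisms starting at
the identity. The isotopy goes from `H 0` to `H 1`. (An isotopy that is parametrised by `[0, 1]`
extends to all of `ℝ` after a reparametrisation that is constant near the end points.) -/
structure AmbientIsotopy (m : ℕ) (M : Type*) [TopologicalSpace M]
    [ChartedSpace (EuclideanSpace ℝ (Fin m)) M] where
  toDiffeo : ℝ → Diffeomorph (𝓡 m) (𝓡 m) M M ∞
  smooth : ContMDiff (𝓘(ℝ, ℝ).prod (𝓡 m)) (𝓡 m) ∞ fun q : ℝ × M => toDiffeo q.1 q.2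
  zero : toDiffeo 0 = Diffeomorph.refl (𝓡 m) M ∞

/-- The framed circles `(c, F)` and `(c', F')` in `M` are ambient isotopic: up to a homotopy of
framings, and up to a (possibly orientation reversing) reparametrisation `σ` of the circle, the
final diffeomorphism of an ambient isotopy carries the first to the second. -/
def FramedAmbientIsotopic (c : Circle → M) (F : FieldsAlong m k c)
    (c' : Circle → M) (F' : FieldsAlong m k c') : Prop :=
  ∃ (H : AmbientIsotopy m M) (σ : Diffeomorph (𝓡 1) (𝓡 1) Circle Circle ∞)
    (G : FieldsAlong m k c), FramingHomotopic c F G ∧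
      (∀ z, H.toDiffeo 1 (c z) = c' (σ z)) ∧
      ∀ z i, tangentMap (𝓡 m) (𝓡 m) (H.toDiffeo 1) ⟨c z, G z i⟩ = ⟨c' (σ z), F' (σ z) i⟩

/-- The orbit of `p` under a circle action `ρ`, as a parametrised circle. -/
def orbitCircle (ρ : Circle →* Equiv.Perm M) (p : M) : Circle → M := fun t => ρ t p

/-- The orbit of `p` is free: `p` has trivial stabiliser. -/
def IsFreeOrbit (ρ : Circle →* Equiv.Perm M) (p : M) : Prop := ∀ t : Circle, ρ t p = p → t = 1

/-- A framing of the orbit of `p` is equivariant if it is of the form `t ↦ t_*(v₁), …, t_*(v_k)`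
for tangent vectors `v₁, …, v_k` at `p` (whose classes are then a basis of the normal space). -/
structure IsEquivariantFraming (ρ : Circle →* Equiv.Perm M) (p : M)
    (F : FieldsAlong m k (orbitCircle ρ p)) : Prop where
  isNormalFraming : IsNormalFraming (orbitCircle ρ p) F
  equivariant : ∃ v : Fin k → TangentSpace (𝓡 m) p,
    ∀ t i, F t i = mfderiv (𝓡 m) (𝓡 m) (ρ t) p (v i)

end General

/-- Euclidean `7`-space, with coordinates numbered from `0` to `6`. -/
abbrev E7 : Type := EuclideanSpace ℝ (Fin 7)

instance finrank_E7 : Fact (Module.finrank ℝ E7 = 6 + 1) := ⟨by simp⟩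

/-- The unit sphere in `ℝ⁷`. -/
abbrev S6 : Type := Metric.sphere (0 : E7) 1

/-- The coordinate circle `{(u, v, 0, 0, 0, 0, 0) | u² + v² = 1}`. -/
def coordCircle (z : Circle) : S6 :=
  ⟨!₂[(z : ℂ).re, (z : ℂ).im, 0, 0, 0, 0, 0], by
    have h := Circle.normSq_coe z
    rw [Complex.normSq_apply] at h
    simp [EuclideanSpace.norm_eq, Fin.sum_univ_succ]
    nlinarith⟩

theorem exists_coordVector (z : Circle) (i : Fin 5) :
    ∃ w : TangentSpace (𝓡 6) (coordCircle z),
      mfderiv (𝓡 6) 𝓘(ℝ, E7) ((↑) : S6 → E7) (coordCircle z) w =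
        EuclideanSpace.single (Fin.natAdd 2 i) (1 : ℝ) := by
  have h := range_mfderiv_coe_sphere (n := 6) (coordCircle z)
  have hm : (EuclideanSpace.single (Fin.natAdd 2 i) (1 : ℝ) : E7) ∈
      (ℝ ∙ ((coordCircle z : S6) : E7))ᗮ := by
    rw [Submodule.mem_orthogonal_singleton_iff_inner_right]
    fin_cases i <;> simp [coordCircle, EuclideanSpace.inner_single_right, Fin.natAdd]
  rw [← h] at hm
  exact hm

/-- The trivial framing of the coordinate circle: the constant vectors `e₃, …, e₇` of the
standard basis `e₁, …, e₇` of `ℝ⁷` (that is, coordinates `2, …, 6` when numbered from `0`),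
regarded as tangent vectors of the sphere. -/
def coordFraming : FieldsAlong 6 5 coordCircle :=
  fun z i => Classical.choose (exists_coordVector z i)

theorem mfderiv_coe_coordFraming (z : Circle) (i : Fin 5) :
    mfderiv (𝓡 6) 𝓘(ℝ, E7) ((↑) : S6 → E7) (coordCircle z) (coordFraming z i) =
      EuclideanSpace.single (Fin.natAdd 2 i) (1 : ℝ) :=
  Classical.choose_spec (exists_coordVector z i)

/-- A normal framing `F` of a circle `c` in `S⁶` is trivial if it is ambient isotopic to the
trivial framing of the coordinate circle. -/
def IsTrivialFraming (c : Circle → S6) (F : FieldsAlong 6 5 c) : Prop :=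
  FramedAmbientIsotopic c F coordCircle coordFraming

/-- The linear map `(z₁, z₂, z₃, x) ↦ (t^(-a) z₁, t^b z₂, t^(a+b) z₃, x)` of `ℝ⁷ = ℂ³ × ℝ`, where
`z₁ = x₀ + i x₁`, `z₂ = x₂ + i x₃`, `z₃ = x₄ + i x₅`, `x = x₆`. -/
def weightMap (a b : ℤ) (t : Circle) (x : E7) : E7 :=
  let w₁ : ℂ := ((t ^ (-a) : Circle) : ℂ) * ⟨x 0, x 1⟩
  let w₂ : ℂ := ((t ^ b : Circle) : ℂ) * ⟨x 2, x 3⟩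
  let w₃ : ℂ := ((t ^ (a + b) : Circle) : ℂ) * ⟨x 4, x 5⟩
  !₂[w₁.re, w₁.im, w₂.re, w₂.im, w₃.re, w₃.im, x 6]

theorem norm_weightMap (a b : ℤ) (t : Circle) (x : E7) : ‖weightMap a b t x‖ = ‖x‖ := by
  have key : ∀ (u : Circle) (p q : ℝ), ((u : ℂ) * ⟨p, q⟩).re ^ 2 + ((u : ℂ) * ⟨p, q⟩).im ^ 2 =
      p ^ 2 + q ^ 2 := by
    intro u p q
    have h := Circle.normSq_coe u
    rw [Complex.normSq_apply] at h
    simp only [Complex.mul_re, Complex.mul_im]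
    linear_combination (p ^ 2 + q ^ 2) * h
  have h1 := key (t ^ (-a)) (x 0) (x 1)
  have h2 := key (t ^ b) (x 2) (x 3)
  have h3 := key (t ^ (a + b)) (x 4) (x 5)
  rw [EuclideanSpace.norm_eq, EuclideanSpace.norm_eq]
  congr 1
  simp only [Real.norm_eq_abs, sq_abs, Fin.sum_univ_seven]
  change ((_ : ℂ).re ^ 2 + (_ : ℂ).im ^ 2 + (_ : ℂ).re ^ 2 + (_ : ℂ).im ^ 2 + (_ : ℂ).re ^ 2 +
    (_ : ℂ).im ^ 2 + x 6 ^ 2) = _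
  linear_combination h1 + h2 + h3

theorem weightMap_one (a b : ℤ) (x : E7) : weightMap a b 1 x = x := by
  ext i
  fin_cases i <;> simp [weightMap]

theorem weightMap_mul (a b : ℤ) (s t : Circle) (x : E7) :
    weightMap a b (s * t) x = weightMap a b s (weightMap a b t x) := by
  ext i
  fin_cases i <;> simp [weightMap, mul_zpow] <;> ring

theorem weightMap_inv_cancel (a b : ℤ) (t : Circle) (x : E7) :
    weightMap a b t⁻¹ (weightMap a b t x) = x := by
  rw [← weightMap_mul, inv_mul_cancel, weightMap_one]

/-- The standard circle action on `S⁶` with weights `-a`, `b`, `a + b`, the restriction of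
`t · (z₁, z₂, z₃, x) = (t^(-a) z₁, t^b z₂, t^(a+b) z₃, x)` to the unit sphere. -/
def standardAction (a b : ℤ) : Circle →* Equiv.Perm S6 where
  toFun t :=
    { toFun := fun p => ⟨weightMap a b t p, by simp [norm_weightMap]⟩
      invFun := fun p => ⟨weightMap a b t⁻¹ p, by simp [norm_weightMap]⟩
      left_inv := fun p => Subtype.ext (weightMap_inv_cancel a b t p)
      right_inv := fun p => Subtype.ext (by
        have h := weightMap_inv_cancel a b t⁻¹ (p : E7)
        rwa [inv_inv] at h) }
  map_one' := Equiv.ext fun p => Subtype.ext (weightMap_one a b p)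
  map_mul' s t := Equiv.ext fun p => Subtype.ext (weightMap_mul a b s t p)

end CircleFraming

end

/-! A framed circle in `S⁶` yields a loop of frames of `ℝ⁷`: the position, the velocity and the five
framing vectors. After Gram–Schmidt this is a loop in a component of `O(7)`, with a class in
`π₁(SO(7)) = ℤ/2`. Homotopies of framings and ambient isotopies deform the loop through loops of
frames, so the class is an invariant of the framed circle.

For an equivariant framing the whole frame, position and velocity included, is moved by the linear
action. The loop is therefore a fixed frame rotated in three planes with weights `-a`, `b`, `a + b`.
Their sum `2b` is even, so the class vanishes, for every reparametrisation of the orbit. For the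
trivial framing of the coordinate circle, position and velocity make one full turn in a plane while
the other five vectors stay fixed; this generates `π₁(SO(7))`. A reversed orientation only changes
the sign of one vector.

The class is computed with spin lifts. Seven real `8 × 8` matrices represent the Clifford algebra of
`ℝ⁷`, and only scalars commute with all of them (`eq_smul_one_of_commute_gammaBasis`). Hence an
invertible matrix implementing a change of orthonormal frames is unique up to a nonzero scalar, a
lift of a loop closes up to a scalar, and the sign of this scalar is independent of the lift
(`IsSpinLift.holonomy_mul_pos`) and constant under homotopy (`SpinTrivial.of_homotopy`). Lifts of
families of frames come from averaging (`exists_spinLift`), lifts of rotations from half-angle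
rotors (`rotor_mul_gamma`). -/

namespace CircleFraming

/-! ### Gamma matrices in dimension seven -/

/-- The algebra of real `8 × 8` matrices, which contains a Clifford system of seven elements. -/
abbrev SpinMat : Type := Matrix (Fin 8) (Fin 8) ℝ

/-- The bit pattern by which the `i`-th gamma matrix permutes the standard basis. -/
def gammaFlip : Fin 7 → Fin 8 := ![5, 4, 6, 2, 3, 1, 7]

/-- The signs of the entries of the gamma matrices. -/
def gammaSign : Fin 7 → Fin 8 → ℤ :=
  ![![1, 1, 1, 1, -1, -1, -1, -1],
    ![1, -1, 1, -1, -1, 1, -1, 1],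
    ![1, 1, -1, -1, 1, 1, -1, -1],
    ![1, 1, -1, -1, -1, -1, 1, 1],
    ![1, -1, 1, -1, 1, -1, 1, -1],
    ![1, -1, -1, 1, 1, -1, -1, 1],
    ![1, -1, -1, 1, -1, 1, 1, -1]]

/-- The gamma matrices: seven anticommuting real matrices with square `-1`. -/
def gammaBasis (i : Fin 7) : SpinMat :=
  Matrix.of fun a b => if a = b ^^^ gammaFlip i then (gammaSign i b : ℝ) else 0

lemma xor_gammaFlip_xor_gammaFlip (i : Fin 7) (a : Fin 8) :
    a ^^^ gammaFlip i ^^^ gammaFlip i = a := by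
  revert i a; decide

lemma mul_gammaBasis_apply (X : SpinMat) (i : Fin 7) (a b : Fin 8) :
    (X * gammaBasis i) a b = X a (b ^^^ gammaFlip i) * gammaSign i b := by
  simp [Matrix.mul_apply, gammaBasis]

lemma gammaBasis_mul_apply (X : SpinMat) (i : Fin 7) (a b : Fin 8) :
    (gammaBasis i * X) a b = gammaSign i (a ^^^ gammaFlip i) * X (a ^^^ gammaFlip i) b := by
  have h : ∀ c : Fin 8, a = c ^^^ gammaFlip i ↔ a ^^^ gammaFlip i = c := by
    intro c
    constructor
    · rintro rfl
      exact xor_gammaFlip_xor_gammaFlip i c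
    · rintro rfl
      exact (xor_gammaFlip_xor_gammaFlip i a).symm
  simp [Matrix.mul_apply, gammaBasis, h]

lemma gammaBasis_mul_self (i : Fin 7) : gammaBasis i * gammaBasis i = -1 := by
  have h : ∀ (i : Fin 7) (b : Fin 8),
      gammaSign i (b ^^^ gammaFlip i) * gammaSign i b = -1 := by decide
  ext a b
  have hb : ((gammaSign i (b ^^^ gammaFlip i) * gammaSign i b : ℤ) : ℝ) = -1 := by
    rw [h]; simp
  push_cast at hb
  rw [mul_gammaBasis_apply]
  simp only [gammaBasis, Matrix.of_apply, xor_gammaFlip_xor_gammaFlip, Matrix.neg_apply,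
    Matrix.one_apply]
  split_ifs <;> simp [hb]

lemma gammaBasis_mul_comm {i j : Fin 7} (hij : i ≠ j) :
    gammaBasis i * gammaBasis j = -(gammaBasis j * gammaBasis i) := by
  have h : ∀ (i j : Fin 7) (b : Fin 8), i ≠ j →
      gammaSign i (b ^^^ gammaFlip j) * gammaSign j b =
        -(gammaSign j (b ^^^ gammaFlip i) * gammaSign i b) := by decide
  have hx : ∀ (i j : Fin 7) (b : Fin 8),
      b ^^^ gammaFlip j ^^^ gammaFlip i = b ^^^ gammaFlip i ^^^ gammaFlip j := by decide
  ext a b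
  have hb : ((gammaSign i (b ^^^ gammaFlip j) * gammaSign j b : ℤ) : ℝ) =
      (-(gammaSign j (b ^^^ gammaFlip i) * gammaSign i b) : ℤ) := by
    rw [h i j b hij]
  push_cast at hb
  rw [mul_gammaBasis_apply, Matrix.neg_apply, mul_gammaBasis_apply]
  simp only [gammaBasis, Matrix.of_apply, hx i j b]
  split_ifs
  · exact hb
  · simp

/-- A matrix that commutes with all gamma matrices is scalar. -/
lemma eq_smul_one_of_commute_gammaBasis {X : SpinMat}
    (hX : ∀ i, X * gammaBasis i = gammaBasis i * X) : X = X 0 0 • (1 : SpinMat) := by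
  have hsq : ∀ (i : Fin 7) (b : Fin 8), gammaSign i b * gammaSign i b = 1 := by decide
  have hsq' : ∀ (i : Fin 7) (b : Fin 8), (gammaSign i b : ℝ) * gammaSign i b = 1 := by
    intro i b
    exact_mod_cast congrArg (Int.cast (R := ℝ)) (hsq i b)
  have hne : ∀ (i : Fin 7) (b : Fin 8), (gammaSign i b : ℝ) ≠ 0 := by
    intro i b h0
    simpa [h0] using hsq' i b
  have hE : ∀ i a b, X a (b ^^^ gammaFlip i) * gammaSign i b =
      gammaSign i (a ^^^ gammaFlip i) * X (a ^^^ gammaFlip i) b := by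
    intro i a b
    rw [← mul_gammaBasis_apply, hX, gammaBasis_mul_apply]
  have hcol : ∀ m : Fin 8, m ≠ 0 → X m 0 = 0 := by
    -- A product of three gamma matrices whose flips cancel is a diagonal sign matrix. For each `m ≠
    -- 0` one of them has entry `1` at `0` and `-1` at `m`; commuting with it forces `X m 0 = -X m
    -- 0`.
    have hs : ∀ m : Fin 8, m ≠ 0 → ∃ i j k : Fin 7,
        0 ^^^ gammaFlip k ^^^ gammaFlip j ^^^ gammaFlip i = 0 ∧
        m ^^^ gammaFlip i ^^^ gammaFlip j ^^^ gammaFlip k = m ∧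
        gammaSign i (0 ^^^ gammaFlip k ^^^ gammaFlip j) * gammaSign j (0 ^^^ gammaFlip k) *
          gammaSign k 0 = 1 ∧
        gammaSign i (m ^^^ gammaFlip i) * (gammaSign j (m ^^^ gammaFlip i ^^^ gammaFlip j) *
          gammaSign k (m ^^^ gammaFlip i ^^^ gammaFlip j ^^^ gammaFlip k)) = -1 := by
      decide +kernel
    intro m hm
    obtain ⟨i, j, k, h1, h2, h3, h4⟩ := hs m hm
    have hc : X * gammaBasis i * gammaBasis j * gammaBasis k =
        gammaBasis i * (gammaBasis j * (gammaBasis k * X)) := by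
      rw [hX, Matrix.mul_assoc, Matrix.mul_assoc, ← Matrix.mul_assoc X, hX, Matrix.mul_assoc,
        hX]
    have hc' := congrFun (congrFun hc m) 0
    rw [mul_gammaBasis_apply, mul_gammaBasis_apply, mul_gammaBasis_apply, gammaBasis_mul_apply,
      gammaBasis_mul_apply, gammaBasis_mul_apply, h1] at hc'
    have h3' := congrArg (Int.cast (R := ℝ)) h3
    have h4' := congrArg (Int.cast (R := ℝ)) h4
    push_cast at h3' h4'
    rw [h2] at hc' h4'
    linear_combination (1 / 2) * hc' - (1 / 2) * X m 0 * h3' + (1 / 2) * X m 0 * h4'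
  -- The seven flips are exactly the nonzero bit patterns, so commuting with a single gamma matrix
  -- determines each remaining column from column `0`.
  have hflip : ∀ b : Fin 8, b ≠ 0 → ∃ i, 0 ^^^ gammaFlip i = b := by decide
  have hx0 : ∀ (i : Fin 7) (a : Fin 8), a ^^^ gammaFlip i = 0 ↔ a = 0 ^^^ gammaFlip i := by
    decide
  ext a b
  rcases eq_or_ne b 0 with rfl | hb
  · rcases eq_or_ne a 0 with rfl | ha
    · simp
    · simp [hcol a ha, ha]
  · obtain ⟨i, rfl⟩ := hflip b hb
    have h := hE i a 0
    rcases eq_or_ne a (0 ^^^ gammaFlip i) with rfl | ha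
    · rw [(hx0 i _).2 rfl, mul_comm] at h
      simpa using mul_left_cancel₀ (hne i 0) h
    · rw [hcol _ (fun h0 => ha ((hx0 i a).1 h0)), mul_zero] at h
      have := (mul_eq_zero.1 h).resolve_right (hne i 0)
      simp [this, ha]

/-- Clifford multiplication by a vector of `ℝ⁷`. -/
def gamma : E7 →ₗ[ℝ] SpinMat where
  toFun v := ∑ i, v i • gammaBasis i
  map_add' v w := by simp [add_smul, Finset.sum_add_distrib]
  map_smul' r v := by simp [mul_smul, Finset.smul_sum]

lemma gamma_apply (v : E7) : gamma v = ∑ i, v i • gammaBasis i := rfl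

@[simp] lemma gamma_single (i : Fin 7) :
    gamma (EuclideanSpace.single i (1 : ℝ)) = gammaBasis i := by
  simp [gamma_apply]

lemma continuous_gamma : Continuous gamma := by
  change Continuous fun v : E7 => ∑ i, v i • gammaBasis i
  fun_prop

lemma gamma_mul_gamma_add (v w : E7) :
    gamma v * gamma w + gamma w * gamma v = (-2 * inner ℝ v w) • (1 : SpinMat) := by
  have hb : ∀ i j : Fin 7, gammaBasis i * gammaBasis j + gammaBasis j * gammaBasis i =
      if i = j then (-2 : ℝ) • (1 : SpinMat) else 0 := by
    intro i j
    split_ifs with h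
    · subst h
      rw [gammaBasis_mul_self, neg_smul, two_smul]
      abel
    · rw [gammaBasis_mul_comm h]; abel
  have h1 : gamma v * gamma w + gamma w * gamma v =
      ∑ i, ∑ j, (v i * w j) • (gammaBasis i * gammaBasis j + gammaBasis j * gammaBasis i) := by
    simp only [gamma_apply, Finset.sum_mul_sum, smul_mul_smul_comm, smul_add,
      Finset.sum_add_distrib]
    congr 1
    rw [Finset.sum_comm]
    simp only [mul_comm (w _)]
  rw [h1]
  simp only [hb, smul_ite, smul_zero, Finset.sum_ite_eq, Finset.mem_univ, if_true, smul_smul,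
    ← Finset.sum_smul, PiLp.inner_apply, Finset.mul_sum]
  congr 1
  refine Finset.sum_congr rfl fun i _ => ?_
  simp
  ring

lemma gamma_mul_self {v : E7} (hv : ‖v‖ = 1) : gamma v * gamma v = -1 := by
  have h := gamma_mul_gamma_add v v
  rw [real_inner_self_eq_norm_sq, hv, ← two_smul ℝ] at h
  have h2 : (2 : ℝ) • (gamma v * gamma v) = (2 : ℝ) • (-1 : SpinMat) := by
    rw [h]; simp
  exact smul_right_injective _ (two_ne_zero) h2

lemma gamma_mul_comm_of_inner_eq_zero {v w : E7} (h : inner ℝ v w = 0) :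
    gamma v * gamma w = -(gamma w * gamma v) := by
  have h' := gamma_mul_gamma_add v w
  rw [h] at h'
  simpa [add_eq_zero_iff_eq_neg] using h'

/-! ### The averaged intertwiner of two orthonormal frames -/

/-- Averaging step for the intertwiner of Clifford multiplications by two frames. -/
def averageStep (v w : E7) (x : SpinMat) : SpinMat := x - gamma w * x * gamma v

/-- A matrix that intertwines Clifford multiplication by the vectors of two frames. -/
def intertwiner (f g : Fin 7 → E7) : SpinMat :=
  (List.finRange 7).foldr (fun i x => averageStep (f i) (g i) x) 1

/-- As `γ(v)⁻¹ = -γ(v)` for a unit vector, the step is `x + γ(w) x γ(v)⁻¹`, the sum over an orbit of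
the involution `x ↦ γ(w) x γ(v)⁻¹`, hence a fixed point of it. -/
lemma gamma_mul_averageStep {v w : E7} (hv : ‖v‖ = 1) (hw : ‖w‖ = 1) (x : SpinMat) :
    gamma w * averageStep v w x = averageStep v w x * gamma v := by
  have h1 := gamma_mul_self hv
  have h2 := gamma_mul_self hw
  simp only [averageStep, mul_sub, sub_mul]
  rw [mul_assoc (gamma w * x), h1, mul_assoc (gamma w) x, ← mul_assoc (gamma w), h2]
  simp only [mul_neg, neg_mul, mul_one, one_mul]
  abel

/-- Averaging in an orthogonal direction keeps the relations already gained: the two anticommutation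
signs cancel. -/
lemma gamma_mul_averageStep_of_inner_eq_zero {v w v' w' : E7} (hv : inner ℝ v v' = 0)
    (hw : inner ℝ w w' = 0) {x : SpinMat} (hx : gamma w * x = x * gamma v) :
    gamma w * averageStep v' w' x = averageStep v' w' x * gamma v := by
  have h1 := gamma_mul_comm_of_inner_eq_zero hv
  have h2 := gamma_mul_comm_of_inner_eq_zero hw
  simp only [averageStep, mul_sub, sub_mul]
  rw [hx, mul_assoc (gamma w') x, ← mul_assoc (gamma w), h2, neg_mul, mul_assoc (gamma w'),
    ← mul_assoc (gamma w), hx, mul_assoc x, h1]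
  simp only [mul_neg, mul_assoc]
  have h3 : gamma v' * gamma v = -(gamma v * gamma v') := by rw [h1, neg_neg]
  rw [h3]
  simp

lemma gamma_mul_intertwiner {f g : Fin 7 → E7} (hf : Orthonormal ℝ f) (hg : Orthonormal ℝ g)
    (i : Fin 7) : gamma (g i) * intertwiner f g = intertwiner f g * gamma (f i) := by
  have key : ∀ l : List (Fin 7), i ∈ l →
      gamma (g i) * l.foldr (fun i x => averageStep (f i) (g i) x) 1 =
        l.foldr (fun i x => averageStep (f i) (g i) x) 1 * gamma (f i) := by
    intro l
    induction l with
    | nil => simp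
    | cons j l ih =>
      intro hi
      simp only [List.foldr_cons]
      rcases eq_or_ne i j with rfl | hij
      · exact gamma_mul_averageStep (hf.1 i) (hg.1 i) _
      · exact gamma_mul_averageStep_of_inner_eq_zero (hf.2 hij) (hg.2 hij)
          (ih ((List.mem_cons.1 hi).resolve_left hij))
  exact key _ (List.mem_finRange i)

/-- For equal frames every step doubles a scalar matrix. This is the only source of invertibility:
nearby frames inherit it by continuity. -/
lemma intertwiner_self {f : Fin 7 → E7} (hf : Orthonormal ℝ f) :
    intertwiner f f = (2 : ℝ) ^ 7 • (1 : SpinMat) := by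
  have key : ∀ l : List (Fin 7), l.foldr (fun i x => averageStep (f i) (f i) x) 1 =
      (2 : ℝ) ^ l.length • (1 : SpinMat) := by
    intro l
    induction l with
    | nil => simp
    | cons j l ih =>
      rw [List.foldr_cons, ih, averageStep, mul_smul_comm, smul_mul_assoc, mul_one,
        gamma_mul_self (hf.1 j), List.length_cons]
      rw [pow_succ', mul_smul, two_smul, smul_neg, sub_neg_eq_add]
  have h := key (List.finRange 7)
  rwa [List.length_finRange] at h

lemma continuous_intertwiner :
    Continuous fun q : (Fin 7 → E7) × (Fin 7 → E7) => intertwiner q.1 q.2 := by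
  have key : ∀ l : List (Fin 7), Continuous fun q : (Fin 7 → E7) × (Fin 7 → E7) =>
      l.foldr (fun i x => averageStep (q.1 i) (q.2 i) x) (1 : SpinMat) := by
    intro l
    induction l with
    | nil => exact continuous_const
    | cons j l ih =>
      simp only [List.foldr_cons, averageStep]
      have h1 : Continuous fun q : (Fin 7 → E7) × (Fin 7 → E7) => gamma (q.1 j) :=
        continuous_gamma.comp (by fun_prop)
      have h2 : Continuous fun q : (Fin 7 → E7) × (Fin 7 → E7) => gamma (q.2 j) :=
        continuous_gamma.comp (by fun_prop)
      exact ih.sub ((h2.mul ih).mul h1)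
  exact key _

-- From here on the explicit matrices no longer matter, only the relations, continuity and the
-- scalar commutant proved above.
attribute [irreducible] gammaBasis gamma averageStep intertwiner

/-! ### Lifting families of frames to the spin group -/

lemma exists_forall_det_intertwiner_ne_zero {E : Type*} [PseudoMetricSpace E] {K : Set E}
    (hK : IsCompact K) {f : E → Fin 7 → E7} (hf : Continuous f)
    (ho : ∀ x, Orthonormal ℝ (f x)) :
    ∃ δ > 0, ∀ x ∈ K, ∀ y ∈ K, dist x y < δ → (intertwiner (f x) (f y)).det ≠ 0 := by
  have hD : Continuous fun q : E × E => (intertwiner (f q.1) (f q.2)).det :=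
    Continuous.matrix_det (continuous_intertwiner.comp
      ((hf.comp continuous_fst).prodMk (hf.comp continuous_snd)))
  have hu := (hK.prod hK).uniformContinuousOn_of_continuous hD.continuousOn
  rw [Metric.uniformContinuousOn_iff] at hu
  -- Tolerance `1` suffices: the determinant on the diagonal is `(2 ^ 7) ^ 8`.
  obtain ⟨δ, hδ, h⟩ := hu 1 one_pos
  refine ⟨δ, hδ, fun x hx y hy hxy h0 => ?_⟩
  have := h (x, x) ⟨hx, hx⟩ (x, y) ⟨hx, hy⟩ (by simpa [Prod.dist_eq, hδ] using hxy)
  simp only [h0, intertwiner_self (ho x), Matrix.det_smul, Matrix.det_one] at this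
  norm_num [Real.dist_eq] at this

/-- A continuous family of orthonormal frames over a compact convex set lifts to a continuous
family of invertible elements of the Clifford algebra. -/
theorem exists_spinLift {E : Type*} [NormedAddCommGroup E] [NormedSpace ℝ E] {K : Set E}
    (hK : IsCompact K) (hc : Convex ℝ K) (h0 : (0 : E) ∈ K) {f : E → Fin 7 → E7}
    (hf : Continuous f) (ho : ∀ x, Orthonormal ℝ (f x)) :
    ∃ u : E → SpinMat, Continuous u ∧ (∀ x ∈ K, (u x).det ≠ 0) ∧
      ∀ x i, u x * gamma (f 0 i) = gamma (f x i) * u x := by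
  obtain ⟨δ, hδ, hdet⟩ := exists_forall_det_intertwiner_ne_zero hK hf ho
  obtain ⟨R, hR⟩ := hK.isBounded.exists_norm_le
  -- The segment from `0` to `x` is cut into `N` pieces, each shorter than `δ`; the lift at `x` is
  -- the product of the intertwiners along the pieces.
  obtain ⟨N, hN⟩ := exists_nat_gt (R / δ)
  have hR0 : 0 ≤ R := by simpa using hR 0 h0
  have hN0 : (0 : ℝ) < N := lt_of_le_of_lt (div_nonneg hR0 hδ.le) hN
  have key : ∀ k : ℕ, k ≤ N → ∃ u : E → SpinMat, Continuous u ∧ (∀ x ∈ K, (u x).det ≠ 0) ∧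
      ∀ x i, u x * gamma (f 0 i) = gamma (f ((k / N : ℝ) • x) i) * u x := by
    intro k
    induction k with
    | zero => exact fun _ => ⟨fun _ => 1, continuous_const, by simp, by simp⟩
    | succ k ih =>
      intro hk
      obtain ⟨u, hu, hud, hui⟩ := ih (by omega)
      have hmem : ∀ j : ℕ, j ≤ N → ∀ x ∈ K, ((j / N : ℝ) • x) ∈ K := fun j hj x hx =>
        hc.smul_mem_of_zero_mem h0 hx
          ⟨by positivity, (div_le_one hN0).2 (by exact_mod_cast hj)⟩
      refine ⟨fun x => intertwiner (f ((k / N : ℝ) • x)) (f (((k + 1 : ℕ) / N : ℝ) • x)) * u x,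
        ?_, ?_, ?_⟩
      · exact (continuous_intertwiner.comp ((hf.comp (continuous_const_smul _)).prodMk
          (hf.comp (continuous_const_smul _)))).mul hu
      · intro x hx
        rw [Matrix.det_mul]
        refine mul_ne_zero (hdet _ (hmem k (by omega) x hx) _ (hmem _ hk x hx) ?_) (hud x hx)
        rw [dist_eq_norm, ← sub_smul, norm_smul]
        have : ((k : ℝ) / N - ((k + 1 : ℕ) : ℝ) / N) = -(1 / N) := by
          push_cast; ring
        rw [this, norm_neg, Real.norm_of_nonneg (by positivity), one_div_mul_eq_div,
          div_lt_iff₀ hN0]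
        rw [div_lt_iff₀ hδ] at hN
        linarith [hR x hx]
      · intro x i
        rw [mul_assoc, hui, ← mul_assoc, ← gamma_mul_intertwiner (ho _) (ho _), mul_assoc]
  obtain ⟨u, hu, hud, hui⟩ := key N le_rfl
  refine ⟨u, hu, hud, fun x i => ?_⟩
  simpa [div_self hN0.ne'] using hui x i

/-- Seven orthonormal vectors span `ℝ⁷`, so the scalar commutant is available for any orthonormal
frame. -/
lemma commute_gammaBasis_of_orthonormal {f : Fin 7 → E7} (hf : Orthonormal ℝ f) {X : SpinMat}
    (hX : ∀ i, X * gamma (f i) = gamma (f i) * X) (i : Fin 7) :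
    X * gammaBasis i = gammaBasis i * X := by
  have hspan : Submodule.span ℝ (Set.range f) = ⊤ :=
    hf.linearIndependent.span_eq_top_of_card_eq_finrank' (by simp)
  have key : ∀ v ∈ Submodule.span ℝ (Set.range f), X * gamma v = gamma v * X := by
    intro v hv
    induction hv using Submodule.span_induction with
    | mem v hv => obtain ⟨j, rfl⟩ := hv; exact hX j
    | zero => simp
    | add v w _ _ hv hw => rw [map_add, mul_add, add_mul, hv, hw]
    | smul r v _ hv => rw [map_smul, mul_smul_comm, smul_mul_assoc, hv]
  rw [← gamma_single]
  exact key _ (hspan ▸ Submodule.mem_top)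

/-- Two invertible matrices that implement the same change of orthonormal frames are
proportional. -/
lemma eq_smul_of_intertwine {f g : Fin 7 → E7} (hf : Orthonormal ℝ f) {u w : SpinMat}
    (hw : w.det ≠ 0) (hui : ∀ i, u * gamma (f i) = gamma (g i) * u)
    (hwi : ∀ i, w * gamma (f i) = gamma (g i) * w) : u = (w⁻¹ * u) 0 0 • w := by
  have h1 : w⁻¹ * w = 1 := Matrix.nonsing_inv_mul _ (isUnit_iff_ne_zero.2 hw)
  have h2 : w * w⁻¹ = 1 := Matrix.mul_nonsing_inv _ (isUnit_iff_ne_zero.2 hw)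
  have hw' : ∀ i, w⁻¹ * gamma (g i) = gamma (f i) * w⁻¹ := by
    intro i
    calc w⁻¹ * gamma (g i) = w⁻¹ * gamma (g i) * (w * w⁻¹) := by rw [h2, mul_one]
      _ = w⁻¹ * (gamma (g i) * w) * w⁻¹ := by simp only [mul_assoc]
      _ = w⁻¹ * w * gamma (f i) * w⁻¹ := by rw [← hwi]; simp only [mul_assoc]
      _ = gamma (f i) * w⁻¹ := by rw [h1, one_mul]
  have hc : ∀ i, (w⁻¹ * u) * gamma (f i) = gamma (f i) * (w⁻¹ * u) := by
    intro i
    rw [mul_assoc, hui, ← mul_assoc, hw', mul_assoc]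
  have h3 := eq_smul_one_of_commute_gammaBasis (commute_gammaBasis_of_orthonormal hf hc)
  calc u = w * (w⁻¹ * u) := by rw [← mul_assoc, h2, one_mul]
    _ = (w⁻¹ * u) 0 0 • w := by
      conv_lhs => rw [h3]
      rw [mul_smul_comm, mul_one]

lemma continuousOn_spinMat_inv {X : Type*} [TopologicalSpace X] {s : Set X} {u : X → SpinMat}
    (hu : ContinuousOn u s) (hd : ∀ x ∈ s, (u x).det ≠ 0) :
    ContinuousOn (fun x => (u x)⁻¹) s := by
  simp only [Matrix.inv_def, Ring.inverse_eq_inv']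
  rw [continuousOn_iff_continuous_domRestrict] at hu ⊢
  exact (Continuous.inv₀ (Continuous.matrix_det hu) fun x => hd x x.2).smul
    (Continuous.matrix_adjugate hu)

/-- `u` is a lift to the Clifford algebra of the path `f` of frames on `[0, 2π]`. -/
structure IsSpinLift (f : ℝ → Fin 7 → E7) (u : ℝ → SpinMat) : Prop where
  continuousOn : ContinuousOn u (Set.Icc 0 (2 * Real.pi))
  det_ne_zero : ∀ t ∈ Set.Icc 0 (2 * Real.pi), (u t).det ≠ 0
  intertwine : ∀ t ∈ Set.Icc 0 (2 * Real.pi), ∀ i, u t * gamma (f 0 i) = gamma (f t i) * u t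

/-- A nowhere vanishing continuous function on an interval has constant sign. -/
lemma mul_pos_of_continuousOn_of_ne_zero {a b : ℝ} (hab : a ≤ b) {g : ℝ → ℝ}
    (hg : ContinuousOn g (Set.Icc a b)) (h0 : ∀ t ∈ Set.Icc a b, g t ≠ 0) : 0 < g a * g b := by
  by_contra hneg
  have ha := h0 a (Set.left_mem_Icc.2 hab)
  have hb := h0 b (Set.right_mem_Icc.2 hab)
  rcases mul_nonpos_iff.1 (not_lt.1 hneg) with ⟨h1, h2⟩ | ⟨h1, h2⟩
  · obtain ⟨t, ht, h⟩ := intermediate_value_Icc' hab hg ⟨h2, h1⟩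
    exact h0 t ht h
  · obtain ⟨t, ht, h⟩ := intermediate_value_Icc hab hg ⟨h1, h2⟩
    exact h0 t ht h

lemma zero_mem_period : (0 : ℝ) ∈ Set.Icc 0 (2 * Real.pi) :=
  Set.left_mem_Icc.2 Real.two_pi_pos.le

lemma two_pi_mem_period : (2 * Real.pi) ∈ Set.Icc 0 (2 * Real.pi) :=
  Set.right_mem_Icc.2 Real.two_pi_pos.le

/-- The holonomies of two lifts of the same loop of frames have the same sign. -/
lemma IsSpinLift.holonomy_mul_pos {f : ℝ → Fin 7 → E7} (ho : Orthonormal ℝ (f 0)) {u w : ℝ → SpinMat}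
    (hu : IsSpinLift f u) (hw : IsSpinLift f w) {c d : ℝ} (hd : d ≠ 0)
    (hc : u (2 * Real.pi) = c • u 0) (hdw : w (2 * Real.pi) = d • w 0) : 0 < c * d := by
  set g : ℝ → ℝ := fun t => ((w t)⁻¹ * u t) 0 0 with hg
  have heq : ∀ t ∈ Set.Icc 0 (2 * Real.pi), u t = g t • w t := fun t ht =>
    eq_smul_of_intertwine ho (hw.det_ne_zero t ht) (hu.intertwine t ht) (hw.intertwine t ht)
  have hne : ∀ t ∈ Set.Icc 0 (2 * Real.pi), g t ≠ 0 := by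
    intro t ht h0
    have h1 := hu.det_ne_zero t ht
    rw [heq t ht, h0, zero_smul] at h1
    exact h1 Matrix.det_zero
  have hgc : ContinuousOn g (Set.Icc 0 (2 * Real.pi)) := by
    have h1 := ContinuousOn.mul (continuousOn_spinMat_inv hw.continuousOn hw.det_ne_zero) hu.continuousOn
    have happ : Continuous fun X : SpinMat => X 0 0 := continuous_apply_apply 0 0
    exact happ.comp_continuousOn h1
  have hpos := mul_pos_of_continuousOn_of_ne_zero Real.two_pi_pos.le hgc hne
  have h0 := zero_mem_period
  have h2 := two_pi_mem_period
  rw [heq _ h2, heq _ h0, hdw, smul_smul, smul_smul] at hc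
  have hw0 : w 0 ≠ 0 := by
    intro h
    have h1 := hw.det_ne_zero 0 h0
    rw [h] at h1
    exact h1 Matrix.det_zero
  have hcd : g (2 * Real.pi) * d = c * g 0 := smul_left_injective ℝ hw0 hc
  have h3 : g 0 ^ 2 * (c * d) = (g 0 * g (2 * Real.pi)) * d ^ 2 := by
    -- The ratio `g` of the two lifts keeps its sign, and `g (2π) * d = c * g 0`, so `c` and `d`
    -- have equal sign.
    linear_combination (-g 0 * d) * hcd
  have h4 : 0 < g 0 ^ 2 * (c * d) := by
    rw [h3]; exact mul_pos hpos (by positivity)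
  exact (mul_pos_iff_of_pos_left (by have := hne 0 h0; positivity)).1 h4

/-- Normalising a lift at the starting point. -/
lemma isSpinLift_mul_inv {f : ℝ → Fin 7 → E7} {e : Fin 7 → E7} {u : ℝ → SpinMat}
    (hu : Continuous u) (hud : ∀ t ∈ Set.Icc 0 (2 * Real.pi), (u t).det ≠ 0)
    (hui : ∀ t i, u t * gamma (e i) = gamma (f t i) * u t) :
    IsSpinLift f fun t => u t * (u 0)⁻¹ := by
  have h0 := hud 0 zero_mem_period
  have hi1 : (u 0)⁻¹ * u 0 = 1 := Matrix.nonsing_inv_mul _ (isUnit_iff_ne_zero.2 h0)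
  have hi2 : u 0 * (u 0)⁻¹ = 1 := Matrix.mul_nonsing_inv _ (isUnit_iff_ne_zero.2 h0)
  refine ⟨(hu.mul continuous_const).continuousOn, fun t ht => ?_, fun t _ i => ?_⟩
  · rw [Matrix.det_mul]
    refine mul_ne_zero (hud t ht) fun h => ?_
    have := congrArg Matrix.det hi1
    rw [Matrix.det_mul, h] at this
    simp at this
  · have hinv : (u 0)⁻¹ * gamma (f 0 i) = gamma (e i) * (u 0)⁻¹ := by
      calc (u 0)⁻¹ * gamma (f 0 i) = (u 0)⁻¹ * (gamma (f 0 i) * u 0) * (u 0)⁻¹ := by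
            rw [mul_assoc, mul_assoc, hi2, mul_one]
        _ = gamma (e i) * (u 0)⁻¹ := by rw [← hui, ← mul_assoc, hi1, one_mul]
    rw [mul_assoc, hinv, ← mul_assoc, hui, mul_assoc]

/-- A loop of frames is spin trivial if it lifts to a loop, up to a positive factor. -/
def SpinTrivial (f : ℝ → Fin 7 → E7) : Prop :=
  ∃ u, IsSpinLift f u ∧ ∃ c : ℝ, 0 < c ∧ u (2 * Real.pi) = c • u 0

/-- Spin triviality of loops of frames is invariant under homotopies. -/
theorem SpinTrivial.of_homotopy {f : ℝ × ℝ → Fin 7 → E7} (hf : Continuous f)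
    (ho : ∀ q, Orthonormal ℝ (f q)) (hper : ∀ s, f (s, 2 * Real.pi) = f (s, 0))
    (h : SpinTrivial fun t => f (0, t)) : SpinTrivial fun t => f (1, t) := by
  obtain ⟨w, hw, d, hd, hwd⟩ := h
  have h0I := zero_mem_period
  have h2I := two_pi_mem_period
  obtain ⟨u, hu, hud, hui⟩ := exists_spinLift
    (K := Set.Icc (0 : ℝ) 1 ×ˢ Set.Icc (0 : ℝ) (2 * Real.pi)) (isCompact_Icc.prod isCompact_Icc)
    ((convex_Icc _ _).prod (convex_Icc _ _)) ⟨by simp, h0I⟩ hf ho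
  have h0 : (0 : ℝ) ∈ Set.Icc (0 : ℝ) 1 := by simp
  have h1 : (1 : ℝ) ∈ Set.Icc (0 : ℝ) 1 := by simp
  set c : ℝ → ℝ := fun s => ((u (s, 0))⁻¹ * u (s, 2 * Real.pi)) 0 0 with hcdef
  -- Periodicity makes the lifts at both ends of the loop implement the same change of frames, from
  -- `f 0` to `f (s, 0)`.
  have heq : ∀ s ∈ Set.Icc (0 : ℝ) 1, u (s, 2 * Real.pi) = c s • u (s, 0) := fun s hs =>
    eq_smul_of_intertwine (ho 0) (hud (s, 0) ⟨hs, h0I⟩) (hui (s, 2 * Real.pi))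
      (fun i => hper s ▸ hui (s, 0) i)
  have hne : ∀ s ∈ Set.Icc (0 : ℝ) 1, c s ≠ 0 := by
    intro s hs h
    have h3 := hud (s, 2 * Real.pi) ⟨hs, h2I⟩
    rw [heq s hs, h, zero_smul] at h3
    exact h3 Matrix.det_zero
  have hcc : ContinuousOn c (Set.Icc (0 : ℝ) 1) := by
    have happ : Continuous fun X : SpinMat => X 0 0 := continuous_apply_apply 0 0
    have ha : ContinuousOn (fun s : ℝ => (u (s, 0))⁻¹) (Set.Icc (0 : ℝ) 1) :=
      continuousOn_spinMat_inv (hu.comp (by fun_prop)).continuousOn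
        fun s hs => hud (s, 0) ⟨hs, h0I⟩
    have hb : Continuous fun s : ℝ => u (s, 2 * Real.pi) := hu.comp (by fun_prop)
    exact happ.comp_continuousOn (ContinuousOn.mul ha hb.continuousOn)
  have hpos := mul_pos_of_continuousOn_of_ne_zero zero_le_one hcc hne
  have hlift : ∀ s ∈ Set.Icc (0 : ℝ) 1,
      IsSpinLift (fun t => f (s, t)) fun t => u (s, t) * (u (s, 0))⁻¹ := fun s hs =>
    isSpinLift_mul_inv (e := f 0) (hu.comp (by fun_prop)) (fun t ht => hud (s, t) ⟨hs, ht⟩)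
      fun t => hui (s, t)
  have hhol : ∀ s ∈ Set.Icc (0 : ℝ) 1, u (s, 2 * Real.pi) * (u (s, 0))⁻¹ =
      c s • (u (s, 0) * (u (s, 0))⁻¹) := by
    intro s hs
    rw [heq s hs, smul_mul_assoc]
  have hc0 : 0 < c 0 * d :=
    IsSpinLift.holonomy_mul_pos (f := fun t => f (0, t)) (ho (0, 0)) (hlift 0 h0) hw hd.ne'
      (hhol 0 h0) hwd
  have hc0' : 0 < c 0 := (mul_pos_iff_of_pos_right hd).1 hc0
  exact ⟨_, hlift 1 h1, c 1, (mul_pos_iff_of_pos_left hc0').1 hpos, hhol 1 h1⟩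

/-! ### Rotations of coordinate planes and their lifts -/

/-- Rotation by the angle `θ` of the plane of the `i`-th and `j`-th coordinates. -/
noncomputable def planeRotLinear (i j : Fin 7) (θ : ℝ) : E7 →ₗ[ℝ] E7 where
  toFun v := v + ((Real.cos θ - 1) * v i - Real.sin θ * v j) • EuclideanSpace.single i (1 : ℝ) +
    (Real.sin θ * v i + (Real.cos θ - 1) * v j) • EuclideanSpace.single j (1 : ℝ)
  map_add' v w := by simp only [PiLp.add_apply]; module
  map_smul' r v := by simp only [PiLp.smul_apply, smul_eq_mul, RingHom.id_apply]; module

lemma planeRotLinear_apply (i j : Fin 7) (θ : ℝ) (v : E7) : planeRotLinear i j θ v =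
    v + ((Real.cos θ - 1) * v i - Real.sin θ * v j) • EuclideanSpace.single i (1 : ℝ) +
    (Real.sin θ * v i + (Real.cos θ - 1) * v j) • EuclideanSpace.single j (1 : ℝ) := rfl

lemma norm_planeRotLinear {i j : Fin 7} (hij : i ≠ j) (θ : ℝ) (v : E7) :
    ‖planeRotLinear i j θ v‖ = ‖v‖ := by
  have h : ‖planeRotLinear i j θ v‖ ^ 2 = ‖v‖ ^ 2 := by
    rw [planeRotLinear_apply, ← real_inner_self_eq_norm_sq, ← real_inner_self_eq_norm_sq]
    simp only [inner_add_left, inner_add_right, inner_smul_left, inner_smul_right,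
      EuclideanSpace.inner_single_left, EuclideanSpace.inner_single_right, PiLp.single_apply,
      hij, hij.symm, if_true, if_false]
    simp only [map_one, conj_trivial, one_mul, mul_one, mul_zero, add_zero]
    linear_combination ((v i) ^ 2 + (v j) ^ 2) * Real.sin_sq_add_cos_sq θ
  exact (sq_eq_sq₀ (norm_nonneg _) (norm_nonneg _)).1 h

/-- Rotation of a coordinate plane as a linear isometry. -/
noncomputable def planeRot {i j : Fin 7} (hij : i ≠ j) (θ : ℝ) : E7 →ₗᵢ[ℝ] E7 where
  toLinearMap := planeRotLinear i j θ
  norm_map' := norm_planeRotLinear hij θ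

lemma planeRot_apply {i j : Fin 7} (hij : i ≠ j) (θ : ℝ) (v : E7) : planeRot hij θ v =
    v + ((Real.cos θ - 1) * v i - Real.sin θ * v j) • EuclideanSpace.single i (1 : ℝ) +
    (Real.sin θ * v i + (Real.cos θ - 1) * v j) • EuclideanSpace.single j (1 : ℝ) := rfl

/-- The action of weights `-a`, `b`, `a + b` as a composition of rotations of planes. -/
noncomputable def weightRot (a b : ℤ) (θ : ℝ) : E7 →ₗᵢ[ℝ] E7 :=
  (planeRot (i := 0) (j := 1) (by decide) ((-a : ℤ) * θ)).comp
    ((planeRot (i := 2) (j := 3) (by decide) (b * θ)).comp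
      (planeRot (i := 4) (j := 5) (by decide) ((a + b : ℤ) * θ)))

lemma coe_circleExp_zpow (n : ℤ) (θ : ℝ) : ((Circle.exp θ ^ n : Circle) : ℂ) =
    ⟨Real.cos (n * θ), Real.sin (n * θ)⟩ := by
  rw [← Circle.exp_zsmul, zsmul_eq_mul, Circle.coe_exp, Complex.exp_mul_I]
  apply Complex.ext <;> simp [← Complex.ofReal_cos, ← Complex.ofReal_sin,
    - Complex.ofReal_mul]

lemma weightMap_circleExp (a b : ℤ) (θ : ℝ) (v : E7) :
    weightMap a b (Circle.exp θ) v = weightRot a b θ v := by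
  have h : weightRot a b θ v = planeRot (i := 0) (j := 1) (by decide) ((-a : ℤ) * θ)
    (planeRot (i := 2) (j := 3) (by decide) (b * θ)
      (planeRot (i := 4) (j := 5) (by decide) ((a + b : ℤ) * θ) v)) := rfl
  rw [h]
  simp only [weightMap, coe_circleExp_zpow, planeRot_apply]
  ext k
  fin_cases k <;> simp [Complex.mul_re, Complex.mul_im] <;> ring

/-- The lift to the Clifford algebra of the rotation of a coordinate plane. -/
noncomputable def rotor (i j : Fin 7) (θ : ℝ) : SpinMat :=
  Real.cos (θ / 2) • (1 : SpinMat) + Real.sin (θ / 2) • (gammaBasis i * gammaBasis j)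

lemma continuous_rotor (i j : Fin 7) : Continuous (rotor i j) := by
  unfold rotor
  exact ((Real.continuous_cos.comp (by fun_prop)).smul continuous_const).add
    ((Real.continuous_sin.comp (by fun_prop)).smul continuous_const)

/-- The half angle is the double cover: a full turn of the plane multiplies the lift by `-1`. -/
lemma rotor_add_int_mul_two_pi (i j : Fin 7) (θ : ℝ) (n : ℤ) :
    rotor i j (θ + n * (2 * Real.pi)) = (-1 : ℝ) ^ n • rotor i j θ := by
  have h : (θ + n * (2 * Real.pi)) / 2 = θ / 2 + n * Real.pi := by ring
  rw [rotor, rotor, h, Real.cos_add_int_mul_pi, Real.sin_add_int_mul_pi, smul_add, smul_smul,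
    smul_smul]

lemma rotor_mul_gamma {i j : Fin 7} (hij : i ≠ j) (θ : ℝ) (v : E7) :
    rotor i j θ * gamma v = gamma (planeRot hij θ v) * rotor i j θ := by
  set e := gammaBasis i with he
  set f := gammaBasis j with hf
  -- The component of `v` orthogonal to the plane: `γ(y)` anticommutes with both factors of the
  -- bivector and so commutes with the rotor, leaving only the two in-plane coordinates to rotate.
  set y : E7 := v - v i • EuclideanSpace.single i (1 : ℝ) - v j • EuclideanSpace.single j (1 : ℝ)
    with hy
  have hyi : gamma y * e = -(e * gamma y) := by
    rw [he, ← gamma_single]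
    apply gamma_mul_comm_of_inner_eq_zero
    simp [EuclideanSpace.inner_single_right, hy, hij]
  have hyj : gamma y * f = -(f * gamma y) := by
    rw [hf, ← gamma_single]
    apply gamma_mul_comm_of_inner_eq_zero
    simp [EuclideanSpace.inner_single_right, hy, hij.symm]
  have hyef : gamma y * (e * f) = e * f * gamma y := by
    rw [← mul_assoc, hyi, neg_mul, mul_assoc, hyj, mul_neg, neg_neg, mul_assoc]
  have hee : e * e = -1 := gammaBasis_mul_self i
  have hff : f * f = -1 := gammaBasis_mul_self j
  have hfe : f * e = -(e * f) := gammaBasis_mul_comm hij.symm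
  have h1 : e * f * e = f := by rw [mul_assoc, hfe, mul_neg, ← mul_assoc, hee]; simp
  have h2 : e * f * f = -e := by rw [mul_assoc, hff]; simp
  have h3 : e * (e * f) = -f := by rw [← mul_assoc, hee]; simp
  have h4 : f * (e * f) = e := by rw [← mul_assoc, hfe, neg_mul, h2, neg_neg]
  have hv : gamma v = gamma y + v i • e + v j • f := by
    rw [hy, map_sub, map_sub, map_smul, map_smul, gamma_single, gamma_single]
    abel
  have hθ : θ = 2 * (θ / 2) := by ring
  have hc : Real.cos θ = Real.cos (θ / 2) ^ 2 - Real.sin (θ / 2) ^ 2 := by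
    conv_lhs => rw [hθ, Real.cos_two_mul']
  have hs : Real.sin θ = 2 * Real.sin (θ / 2) * Real.cos (θ / 2) := by
    conv_lhs => rw [hθ, Real.sin_two_mul]
  have hcs := Real.sin_sq_add_cos_sq (θ / 2)
  rw [planeRot_apply, map_add, map_add, map_smul, map_smul, gamma_single, gamma_single, rotor,
    ← he, ← hf, hv, hc, hs]
  simp only [mul_add, add_mul, smul_mul_assoc, mul_smul_comm, one_mul, mul_one, hyef, h1, h2, h3,
    h4]
  match_scalars
  · ring
  · ring
  · linear_combination (-(v i) * Real.cos (θ / 2) + v j * Real.sin (θ / 2)) * hcs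
  · linear_combination (-(v j) * Real.cos (θ / 2) - v i * Real.sin (θ / 2)) * hcs

lemma det_rotor_ne_zero {i j : Fin 7} (hij : i ≠ j) (θ : ℝ) : (rotor i j θ).det ≠ 0 := by
  -- The bivector squares to `-1`, so rotors multiply like unit complex numbers.
  have h : rotor i j θ * rotor i j (-θ) = 1 := by
    have hef : gammaBasis i * gammaBasis j * (gammaBasis i * gammaBasis j) = -1 := by
      rw [← mul_assoc, mul_assoc (gammaBasis i), gammaBasis_mul_comm hij.symm, mul_neg, neg_mul,
        ← mul_assoc, gammaBasis_mul_self, mul_assoc, gammaBasis_mul_self]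
      simp
    simp only [rotor, neg_div, Real.cos_neg, Real.sin_neg, mul_add, add_mul, smul_mul_assoc,
      mul_smul_comm, one_mul, mul_one, hef, neg_smul, mul_neg, smul_neg]
    match_scalars
    · linear_combination Real.sin_sq_add_cos_sq (θ / 2)
    · ring
  intro h0
  have := congrArg Matrix.det h
  rw [Matrix.det_mul, h0] at this
  simp at this

/-- The loop of frames obtained by one full rotation of a coordinate plane is not spin trivial. -/
theorem not_spinTrivial_planeRot {i j : Fin 7} (hij : i ≠ j) {g : Fin 7 → E7}
    (hg : Orthonormal ℝ g) {f : ℝ → Fin 7 → E7} (hf : ∀ t k, f t k = planeRot hij t (g k)) :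
    ¬ SpinTrivial f := by
  rintro ⟨u, hu, c, hc, huc⟩
  have hlift : IsSpinLift f fun t => rotor i j t * (rotor i j 0)⁻¹ :=
    isSpinLift_mul_inv (e := g) (continuous_rotor i j) (fun t _ => det_rotor_ne_zero hij t)
      fun t k => by rw [hf, rotor_mul_gamma hij]
  have ho : Orthonormal ℝ (f 0) := by
    have : f 0 = planeRot hij 0 ∘ g := funext fun k => hf 0 k
    rw [this]
    exact hg.comp_linearIsometry _
  have hd : rotor i j (2 * Real.pi) * (rotor i j 0)⁻¹ =
      (-1 : ℝ) • (rotor i j 0 * (rotor i j 0)⁻¹) := by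
    have := rotor_add_int_mul_two_pi i j 0 1
    simp only [Int.cast_one, one_mul, zero_add, zpow_one] at this
    rw [this, smul_mul_assoc]
  have := IsSpinLift.holonomy_mul_pos (f := f) ho hu hlift (c := c) (by norm_num) huc hd
  linarith

/-- A loop of frames moved by the weights `-a`, `b`, `a + b` is spin trivial. -/
theorem spinTrivial_weightMap (a b : ℤ) {g : Fin 7 → E7} {f : ℝ → Fin 7 → E7} {h : ℝ → ℝ}
    (hh : Continuous h) {k : ℤ} (hk : h (2 * Real.pi) = h 0 + k * (2 * Real.pi))
    (hf : ∀ t i, f t i = weightMap a b (Circle.exp (h t)) (g i)) : SpinTrivial f := by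
  set w : ℝ → SpinMat := fun t => rotor 0 1 ((-a : ℤ) * h t) *
    (rotor 2 3 (b * h t) * rotor 4 5 ((a + b : ℤ) * h t)) with hw
  have h01 : (0 : Fin 7) ≠ 1 := by decide
  have h23 : (2 : Fin 7) ≠ 3 := by decide
  have h45 : (4 : Fin 7) ≠ 5 := by decide
  refine ⟨_, isSpinLift_mul_inv (e := g) (u := w) ?_ ?_ ?_, 1, one_pos, ?_⟩
  · exact ((continuous_rotor _ _).comp (by fun_prop)).mul
      (((continuous_rotor _ _).comp (by fun_prop)).mul ((continuous_rotor _ _).comp (by fun_prop)))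
  · intro t _
    rw [hw, Matrix.det_mul, Matrix.det_mul]
    exact mul_ne_zero (det_rotor_ne_zero h01 _)
      (mul_ne_zero (det_rotor_ne_zero h23 _) (det_rotor_ne_zero h45 _))
  · intro t i
    rw [hf, weightMap_circleExp]
    simp only [hw, mul_assoc, rotor_mul_gamma h45]
    rw [← mul_assoc (rotor 2 3 _), rotor_mul_gamma h23, mul_assoc,
      ← mul_assoc (rotor 0 1 _), rotor_mul_gamma h01, mul_assoc]
    rfl
  · have hk' : ∀ (i j : Fin 7) (n : ℤ), rotor i j (n * h (2 * Real.pi)) =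
        (-1 : ℝ) ^ (n * k) • rotor i j (n * h 0) := by
      intro i j n
      rw [← rotor_add_int_mul_two_pi, hk]
      congr 1
      push_cast
      ring
    -- This is where the weights enter: `(a + b) + b - a = 2b`, so the three signs cancel whatever
    -- the winding number `k`.
    have hone : (-1 : ℝ) ^ ((a + b) * k) * (-1 : ℝ) ^ (b * k) * (-1 : ℝ) ^ (-a * k) = 1 := by
      rw [← zpow_add₀ (by norm_num), ← zpow_add₀ (by norm_num)]
      exact Even.neg_one_zpow ⟨b * k, by ring⟩
    have hw2 : w (2 * Real.pi) = w 0 := by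
      simp only [hw, hk', smul_mul_assoc, mul_smul_comm, smul_smul]
      rw [hone, one_smul]
    simp only [hw2, one_smul]

/-! ### Gram–Schmidt orthonormalisation in families -/

open InnerProductSpace in
lemma gramSchmidt_eq (f : Fin 7 → E7) (n : Fin 7) : gramSchmidt ℝ f n = f n -
    ∑ i ∈ Finset.Iio n,
      (inner ℝ (gramSchmidt ℝ f i) (f n) / ‖gramSchmidt ℝ f i‖ ^ 2) • gramSchmidt ℝ f i :=
  eq_sub_of_add_eq (gramSchmidt_def'' ℝ f n).symm

open InnerProductSpace in
lemma continuous_gramSchmidtNormed {X : Type*} [TopologicalSpace X] {f : X → Fin 7 → E7}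
    (hf : Continuous f) (hl : ∀ x, LinearIndependent ℝ (f x)) :
    Continuous fun x => gramSchmidtNormed ℝ (f x) := by
  have hn : ∀ n x, ‖gramSchmidt ℝ (f x) n‖ ≠ 0 := fun n x =>
    norm_ne_zero_iff.2 (gramSchmidt_ne_zero n (hl x))
  have hfn : ∀ n, Continuous fun x => f x n := fun n => (continuous_apply n).comp hf
  have key : ∀ n : Fin 7, Continuous fun x => gramSchmidt ℝ (f x) n := by
    intro n
    induction n using WellFoundedLT.induction with
    | ind n ih =>
      simp only [gramSchmidt_eq _ n]
      refine (hfn n).sub (continuous_finsetSum _ fun i hi => ?_)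
      have hi' := ih i (Finset.mem_Iio.1 hi)
      exact ((hi'.inner (hfn n)).div (hi'.norm.pow 2) fun x => pow_ne_zero 2 (hn i x)).smul hi'
  refine continuous_pi fun n => ?_
  exact ((key n).norm.inv₀ (hn n)).smul (key n)

open InnerProductSpace in
-- Orthonormalising an equivariant frame therefore yields an equivariant orthonormal frame.
lemma gramSchmidtNormed_comp_linearIsometry (L : E7 →ₗᵢ[ℝ] E7) (f : Fin 7 → E7) (n : Fin 7) :
    gramSchmidtNormed ℝ (fun i => L (f i)) n = L (gramSchmidtNormed ℝ f n) := by
  have key : ∀ n : Fin 7, gramSchmidt ℝ (fun i => L (f i)) n = L (gramSchmidt ℝ f n) := by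
    intro n
    induction n using WellFoundedLT.induction with
    | ind n ih =>
      rw [gramSchmidt_eq, gramSchmidt_eq f n, map_sub, map_sum]
      congr 1
      refine Finset.sum_congr rfl fun i hi => ?_
      rw [ih i (Finset.mem_Iio.1 hi), L.inner_map_map, L.norm_map, map_smul]
  simp only [gramSchmidtNormed, key, L.norm_map, map_smul]

open InnerProductSpace in
lemma gramSchmidtNormed_smul_single (d : Fin 7 → ℝ) (n : Fin 7) :
    gramSchmidtNormed ℝ (fun i => d i • (EuclideanSpace.single i (1 : ℝ) : E7)) n =
      (|d n|⁻¹ * d n) • EuclideanSpace.single n (1 : ℝ) := by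
  have h : gramSchmidt ℝ (fun i => d i • (EuclideanSpace.single i (1 : ℝ) : E7)) =
      fun i => d i • (EuclideanSpace.single i (1 : ℝ) : E7) := by
    apply gramSchmidt_of_orthogonal
    intro i j hij
    simp [inner_smul_left, inner_smul_right, EuclideanSpace.inner_single_left, hij]
  simp [gramSchmidtNormed, h, norm_smul, smul_smul]

/-! ### Tangent vectors of the sphere as vectors of the ambient space -/

/-- A tangent vector of the sphere as a vector of the ambient Euclidean space. -/
noncomputable def ambient (v : TangentBundle (𝓡 6) S6) : E7 :=
  (tangentMap (𝓡 6) 𝓘(ℝ, E7) ((↑) : S6 → E7) v).2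

lemma continuous_ambient : Continuous ambient :=
  (contMDiff_snd_tangentBundle_modelSpace (n := 0) E7 𝓘(ℝ, E7)).continuous.comp
    ((contMDiff_coe_sphere (m := 1) (n := 6) (E := E7)).continuous_tangentMap le_rfl)

/-- The inclusion of a tangent space of the sphere into the ambient space. -/
noncomputable def ambientLinear (x : S6) : TangentSpace (𝓡 6) x →ₗ[ℝ] E7 :=
  (mfderiv (𝓡 6) 𝓘(ℝ, E7) ((↑) : S6 → E7) x).toLinearMap

lemma ker_ambientLinear (x : S6) : LinearMap.ker (ambientLinear x) = ⊥ :=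
  LinearMap.ker_eq_bot.2 (injective_mvfderiv_subtypeVal_sphere (n := 6) x)

lemma range_ambientLinear (x : S6) : LinearMap.range (ambientLinear x) = (ℝ ∙ (x : E7))ᗮ :=
  range_mvfderiv_subtypeVal (n := 6) x

/-- The frame of `ℝ⁷` that consists of a base point and six tangent vectors of the sphere. -/
noncomputable def sphereFrame (W : Fin 6 → TangentBundle (𝓡 6) S6) : Fin 7 → E7 :=
  Fin.cons ((W 0).1 : E7) fun i => ambient (W i)

lemma continuous_sphereFrame {X : Type*} [TopologicalSpace X]
    {W : X → Fin 6 → TangentBundle (𝓡 6) S6} (hW : ∀ i, Continuous fun x => W x i) :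
    Continuous fun x => sphereFrame (W x) := by
  refine continuous_pi fun i => ?_
  refine Fin.cases ?_ (fun j => ?_) i
  · exact continuous_subtype_val.comp ((FiberBundle.continuous_proj _ _).comp (hW 0))
  · exact continuous_ambient.comp (hW j)

/-- The base point is a unit vector orthogonal to its tangent space, so it lies outside the span of
tangent vectors. -/
lemma linearIndependent_sphereFrame {x : S6} {w : Fin 6 → TangentSpace (𝓡 6) x}
    (hw : LinearIndependent ℝ w) : LinearIndependent ℝ (sphereFrame fun i => ⟨x, w i⟩) := by
  refine LinearIndependent.finCons (hw.map' (ambientLinear x) (ker_ambientLinear x)) fun hx => ?_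
  have hr : Submodule.span ℝ (Set.range (ambientLinear x ∘ w)) ≤ (ℝ ∙ (x : E7))ᗮ := by
    rw [← range_ambientLinear, Submodule.span_le]
    rintro _ ⟨i, rfl⟩
    exact ⟨w i, rfl⟩
  have h0 := Submodule.mem_orthogonal_singleton_iff_inner_right.1 (hr hx)
  rw [real_inner_self_eq_norm_sq, norm_eq_of_mem_sphere] at h0
  norm_num at h0

/-! ### Continuity of derivatives in families of maps -/

section Family

variable {E : Type*} [NormedAddCommGroup E] [NormedSpace ℝ E]
  {H : Type*} [TopologicalSpace H] {I : ModelWithCorners ℝ E H}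
  {P : Type*} [TopologicalSpace P] [ChartedSpace H P] [IsManifold I 1 P]
  {E' : Type*} [NormedAddCommGroup E'] [NormedSpace ℝ E']
  {H' : Type*} [TopologicalSpace H'] {I' : ModelWithCorners ℝ E' H'}
  {M : Type*} [TopologicalSpace M] [ChartedSpace H' M] [IsManifold I' 1 M]
  {E'' : Type*} [NormedAddCommGroup E''] [NormedSpace ℝ E'']
  {H'' : Type*} [TopologicalSpace H''] {I'' : ModelWithCorners ℝ E'' H''}
  {N : Type*} [TopologicalSpace N] [ChartedSpace H'' N] [IsManifold I'' 1 N]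

/-- The derivatives in the direction of the second factor of a smooth family of maps depend
continuously on the parameter and on the tangent vector. -/
lemma continuous_tangentMap_family {Φ : P × M → N} (hΦ : ContMDiff (I.prod I') I'' 1 Φ)
    {X : Type*} [TopologicalSpace X] {q : X → P} (hq : Continuous q)
    {v : X → TangentBundle I' M} (hv : Continuous v) :
    Continuous fun x => tangentMap I' I'' (fun y => Φ (q x, y)) (v x) := by
  -- The derivative in the second factor is the full derivative of `Φ` on the pair of `v` and the
  -- zero vector in the parameter direction.
  have hz : Continuous fun x => (⟨q x, 0⟩ : TangentBundle I P) :=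
    (Bundle.contMDiff_zeroSection (n := 1) (IB := I) ℝ
      (TangentSpace I : P → Type _)).continuous.comp hq
  have h1 : Continuous fun x => tangentMap (I.prod I') I'' Φ
      ((equivTangentBundleProd I P I' M).symm (⟨q x, 0⟩, v x)) :=
    (hΦ.continuous_tangentMap le_rfl).comp
      ((contMDiff_equivTangentBundleProd_symm (n := 0)).continuous.comp (hz.prodMk hv))
  convert h1 using 2 with x
  have hm : MDifferentiableAt (I.prod I') I'' Φ (q x, (v x).1) :=
    (hΦ _).mdifferentiableAt one_ne_zero
  have h2 : MDifferentiableAt I' (I.prod I') (fun y => (q x, y)) (v x).1 :=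
    mdifferentiableAt_const.prodMk mdifferentiableAt_id
  have h3 := tangentMap_comp_at (I := I') (I' := I.prod I') (I'' := I'') (v x) hm h2
  have h4 : Φ ∘ (fun y => (q x, y)) = fun y => Φ (q x, y) := rfl
  rw [h4] at h3
  rw [h3]
  congr 1
  simp only [tangentMap, mfderiv_prod_right]
  rfl

end Family

/-! ### Bases of a quotient by a line -/

section LinearAlgebra

variable {V : Type*} [AddCommGroup V] [Module ℝ V] {n : ℕ}

lemma linearIndependent_cons_of_mkQ {τ : V} (hτ : τ ≠ 0) {w : Fin n → V}
    (hw : LinearIndependent ℝ fun i => (ℝ ∙ τ).mkQ (w i)) :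
    LinearIndependent ℝ (Fin.cons τ w : Fin (n + 1) → V) := by
  rw [Fintype.linearIndependent_iff]
  intro g hg
  rw [Fin.sum_univ_succ] at hg
  simp only [Fin.cons_zero, Fin.cons_succ] at hg
  have h1 := congrArg (ℝ ∙ τ).mkQ hg
  have h2 : (ℝ ∙ τ).mkQ τ = 0 :=
    (Submodule.Quotient.mk_eq_zero _).2 (Submodule.mem_span_singleton_self τ)
  rw [map_add, map_smul, h2, smul_zero, zero_add, map_sum, map_zero] at h1
  simp only [map_smul] at h1
  have h3 := Fintype.linearIndependent_iff.1 hw (fun i => g i.succ) h1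
  simp only [h3, zero_smul, Finset.sum_const_zero, add_zero] at hg
  intro i
  refine Fin.cases ?_ (fun j => h3 j) i
  exact (smul_eq_zero.1 hg).resolve_right hτ

lemma mkQ_basis_of_linearIndependent_cons [FiniteDimensional ℝ V]
    (hV : Module.finrank ℝ V = n + 1) {τ : V} {w : Fin n → V}
    (h : LinearIndependent ℝ (Fin.cons τ w : Fin (n + 1) → V)) :
    LinearIndependent ℝ (fun i => (ℝ ∙ τ).mkQ (w i)) ∧
      Submodule.span ℝ (Set.range fun i => (ℝ ∙ τ).mkQ (w i)) = ⊤ := by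
  have hli : LinearIndependent ℝ fun i => (ℝ ∙ τ).mkQ (w i) := by
    rw [Fintype.linearIndependent_iff]
    intro g hg
    have h1 : (ℝ ∙ τ).mkQ (∑ i, g i • w i) = 0 := by
      rw [map_sum]; simpa only [map_smul] using hg
    obtain ⟨r, hr⟩ := Submodule.mem_span_singleton.1 ((Submodule.Quotient.mk_eq_zero _).1 h1)
    have h2 := Fintype.linearIndependent_iff.1 h (Fin.cons (-r) g) (by
      rw [Fin.sum_univ_succ]
      simp only [Fin.cons_zero, Fin.cons_succ]
      rw [← hr, neg_smul, neg_add_cancel])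
    intro i
    simpa using h2 i.succ
  have hτ : τ ≠ 0 := by simpa using h.ne_zero 0
  refine ⟨hli, hli.span_eq_top_of_card_eq_finrank' ?_⟩
  have := Submodule.finrank_quotient_add_finrank (ℝ ∙ τ)
  rw [finrank_span_singleton hτ, hV] at this
  simpa using (Nat.add_right_cancel this).symm

lemma exists_linearIndependent_cons [FiniteDimensional ℝ V]
    (hV : Module.finrank ℝ V = n + 1) {τ : V} (hτ : τ ≠ 0) :
    ∃ w : Fin n → V, LinearIndependent ℝ (Fin.cons τ w : Fin (n + 1) → V) := by
  have hq := Submodule.finrank_quotient_add_finrank (ℝ ∙ τ)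
  rw [finrank_span_singleton hτ, hV] at hq
  let b := Module.finBasisOfFinrankEq ℝ (V ⧸ (ℝ ∙ τ)) (Nat.add_right_cancel hq)
  choose w hw using fun i => (ℝ ∙ τ).mkQ_surjective (b i)
  refine ⟨w, linearIndependent_cons_of_mkQ hτ ?_⟩
  simpa only [hw] using b.linearIndependent

end LinearAlgebra

/-! ### The geometry of the standard action -/

lemma contDiff_complexToE7 : ContDiff ℝ ∞ fun q : (ℂ × ℂ × ℂ) × E7 =>
    (!₂[(q.1.1 * (⟨q.2 0, q.2 1⟩ : ℂ)).re, (q.1.1 * (⟨q.2 0, q.2 1⟩ : ℂ)).im,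
      (q.1.2.1 * (⟨q.2 2, q.2 3⟩ : ℂ)).re, (q.1.2.1 * (⟨q.2 2, q.2 3⟩ : ℂ)).im,
      (q.1.2.2 * (⟨q.2 4, q.2 5⟩ : ℂ)).re, (q.1.2.2 * (⟨q.2 4, q.2 5⟩ : ℂ)).im, q.2 6] : E7) := by
  have hre : ContDiff ℝ ∞ Complex.re := Complex.reCLM.contDiff
  have him : ContDiff ℝ ∞ Complex.im := Complex.imCLM.contDiff
  rw [contDiff_euclidean]
  intro i
  fin_cases i <;> simp [Complex.mul_re, Complex.mul_im] <;> fun_prop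

lemma contMDiff_circle_zpow (n : ℤ) : ContMDiff (𝓡 1) (𝓡 1) ∞ fun z : Circle => z ^ n := by
  have : LieGroup (𝓡 1) ∞ Circle := LieGroup.of_le (n := ω) le_top
  obtain ⟨k, rfl | rfl⟩ := n.eq_nat_or_neg
  · simpa using contMDiff_pow k
  · simpa using (contMDiff_pow k).inv

lemma contMDiff_standardAction (a b : ℤ) : ContMDiff ((𝓡 1).prod (𝓡 6)) (𝓡 6) ∞
    fun q : Circle × S6 => standardAction a b q.1 q.2 := by
  have : Fact (Module.finrank ℝ ℂ = 1 + 1) := ⟨Complex.finrank_real_complex⟩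
  have hc : ∀ n : ℤ, ContMDiff ((𝓡 1).prod (𝓡 6)) 𝓘(ℝ, ℂ) ∞
      fun q : Circle × S6 => ((q.1 ^ n : Circle) : ℂ) := fun n =>
    (contMDiff_coe_sphere (E := ℂ) (n := 1)).comp
      ((contMDiff_circle_zpow n).comp contMDiff_fst)
  have hx : ContMDiff ((𝓡 1).prod (𝓡 6)) 𝓘(ℝ, E7) ∞ fun q : Circle × S6 => (q.2 : E7) :=
    (contMDiff_coe_sphere (E := E7) (n := 6)).comp contMDiff_snd
  have h := contDiff_complexToE7.contMDiff.comp
    (((hc (-a)).prodMk_space ((hc b).prodMk_space (hc (a + b)))).prodMk_space hx)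
  exact ContMDiff.codRestrict_sphere (n := 6) h _

/-! ### The tangent field of an orbit -/

instance : LieGroup (𝓡 1) (minSmoothness ℝ 3) Circle := LieGroup.of_le (n := ω) le_top

/-- A nowhere vanishing invariant tangent vector field on the circle. -/
noncomputable def circleField (z : Circle) : TangentSpace (𝓡 1) z :=
  mulInvariantVectorField (I := 𝓡 1) (G := Circle)
    (EuclideanSpace.single 0 1 : EuclideanSpace ℝ (Fin 1)) z

lemma continuous_circleField :
    Continuous fun z : Circle => (⟨z, circleField z⟩ : TangentBundle (𝓡 1) Circle) :=
  (contMDiff_mulInvariantVectorField (I := 𝓡 1) (G := Circle)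
    (EuclideanSpace.single 0 1 : EuclideanSpace ℝ (Fin 1))).continuous

lemma contMDiff_circle_mul_left (z : Circle) :
    ContMDiff (𝓡 1) (𝓡 1) ∞ fun w : Circle => z * w := by
  have : LieGroup (𝓡 1) ∞ Circle := LieGroup.of_le (n := ω) le_top
  exact contMDiff_mul_left

/-- Left translation by `z⁻¹` carries the vector back to the nonzero vector chosen at `1`. -/
lemma circleField_ne_zero (z : Circle) : circleField z ≠ 0 := by
  intro h
  have h1 : (fun w : Circle => z⁻¹ * w) ∘ (fun w => z * w) = id := by
    ext w; simp
  have h2 := mfderiv_comp_apply (I := 𝓡 1) (I' := 𝓡 1) (I'' := 𝓡 1) (1 : Circle)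
    ((contMDiff_circle_mul_left z⁻¹ (z * 1)).mdifferentiableAt (by simp))
    ((contMDiff_circle_mul_left z 1).mdifferentiableAt (by simp))
    (EuclideanSpace.single 0 1 : EuclideanSpace ℝ (Fin 1))
  have h3 : mfderiv (𝓡 1) (𝓡 1) (fun w : Circle => z * w) 1
      (EuclideanSpace.single 0 1 : EuclideanSpace ℝ (Fin 1)) = 0 := h
  rw [h1, h3, mfderiv_id, map_zero] at h2
  have h4 : (EuclideanSpace.single 0 1 : EuclideanSpace ℝ (Fin 1)) = 0 := h2
  simpa using congrArg (fun v : EuclideanSpace ℝ (Fin 1) => v 0) h4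

lemma exists_eq_smul_of_ne_zero {z : Circle} {u : TangentSpace (𝓡 1) z} (hu : u ≠ 0)
    (v : TangentSpace (𝓡 1) z) : ∃ r : ℝ, r • u = v := by
  have h : ∀ u v : EuclideanSpace ℝ (Fin 1), u ≠ 0 → ∃ r : ℝ, r • u = v := fun u v hu =>
    exists_smul_eq_of_finrank_eq_one (by simp) hu v
  exact h u v hu

/-- The tangent field of a parametrised circle. -/
noncomputable def velocity (c : Circle → S6) (z : Circle) : TangentSpace (𝓡 6) (c z) :=
  mfderiv (𝓡 1) (𝓡 6) c z (circleField z)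

lemma tangentLine_eq_span (c : Circle → S6) (z : Circle) :
    tangentLine c z = ℝ ∙ velocity c z := by
  apply le_antisymm
  · rintro _ ⟨v, rfl⟩
    obtain ⟨r, rfl⟩ := exists_eq_smul_of_ne_zero (circleField_ne_zero z) v
    exact Submodule.mem_span_singleton.2
      ⟨r, (map_smul (mfderiv (𝓡 1) (𝓡 6) c z) r (circleField z)).symm⟩
  · rw [Submodule.span_singleton_le_iff_mem]
    exact ⟨_, rfl⟩

lemma continuous_velocity {c : Circle → S6} (hc : ContMDiff (𝓡 1) (𝓡 6) ∞ c) :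
    Continuous fun z => (⟨c z, velocity c z⟩ : TangentBundle (𝓡 6) S6) :=
  (hc.continuous_tangentMap (by simp)).comp continuous_circleField

lemma contMDiff_orbitCircle (a b : ℤ) (p : S6) :
    ContMDiff (𝓡 1) (𝓡 6) ∞ (orbitCircle (standardAction a b) p) := by
  have h : ContMDiff (𝓡 1) ((𝓡 1).prod (𝓡 6)) ∞ fun z : Circle => (z, p) :=
    contMDiff_id.prodMk contMDiff_const
  exact (contMDiff_standardAction a b).comp h

lemma contMDiff_standardAction_apply (a b : ℤ) (z : Circle) :
    ContMDiff (𝓡 6) (𝓡 6) ∞ (standardAction a b z) := by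
  have h : ContMDiff (𝓡 6) ((𝓡 1).prod (𝓡 6)) ∞ fun q : S6 => (z, q) :=
    contMDiff_const.prodMk contMDiff_id
  have h2 := (contMDiff_standardAction a b).comp h
  exact h2

/-- The linear isometry by which an element of the circle acts. -/
noncomputable def weightIsometry (a b : ℤ) (z : Circle) : E7 →ₗᵢ[ℝ] E7 :=
  weightRot a b (Complex.arg z)

lemma weightIsometry_apply (a b : ℤ) (z : Circle) (v : E7) :
    weightIsometry a b z v = weightMap a b z v := by
  rw [weightIsometry, ← weightMap_circleExp, Circle.exp_arg]

lemma coe_standardAction (a b : ℤ) (z : Circle) (q : S6) :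
    (standardAction a b z q : E7) = weightIsometry a b z q := by
  rw [weightIsometry_apply]; rfl

/-! ### Derivatives computed in the ambient space -/

section Derivative

variable {E : Type*} [NormedAddCommGroup E] [NormedSpace ℝ E] {H : Type*} [TopologicalSpace H]
  (I : ModelWithCorners ℝ E H) {N : Type*} [TopologicalSpace N] [ChartedSpace H N]

/-- The derivative of a map into `ℝ⁷`, with values in `ℝ⁷`. -/
noncomputable def vectorDeriv (g : N → E7) (x : N) : TangentSpace I x →ₗ[ℝ] E7 :=
  (mfderiv I 𝓘(ℝ, E7) g x).toLinearMap

variable {I}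

lemma vectorDeriv_linearIsometry_comp (L : E7 →ₗᵢ[ℝ] E7) {g : N → E7} {x : N}
    (hg : MDifferentiableAt I 𝓘(ℝ, E7) g x) (u : TangentSpace I x) :
    vectorDeriv I (fun y => L (g y)) x u = L (vectorDeriv I g x u) := by
  have h := mfderiv_comp_apply (I := I) (I' := 𝓘(ℝ, E7)) (I'' := 𝓘(ℝ, E7)) x
    (L.toContinuousLinearMap.contMDiff.mdifferentiableAt (n := 1) one_ne_zero) hg u
  rw [ContinuousLinearMap.mfderiv_eq] at h
  exact h

lemma ambient_mfderiv {g : N → S6} {x : N} (hg : MDifferentiableAt I (𝓡 6) g x)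
    (u : TangentSpace I x) :
    ambient ⟨g x, mfderiv I (𝓡 6) g x u⟩ = vectorDeriv I (fun y => (g y : E7)) x u :=
  (mfderiv_comp_apply (I := I) (I' := 𝓡 6) (I'' := 𝓘(ℝ, E7)) x
    ((contMDiff_coe_sphere (n := 6) (m := 1) (g x)).mdifferentiableAt one_ne_zero) hg u).symm

end Derivative

lemma mdifferentiableAt_coe_sphere (q : S6) :
    MDifferentiableAt (𝓡 6) 𝓘(ℝ, E7) ((↑) : S6 → E7) q :=
  (contMDiff_coe_sphere (n := 6) (m := 1) q).mdifferentiableAt one_ne_zero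

/-- The action is the restriction of linear isometries of `ℝ⁷`, so its derivative is the same
isometry. -/
lemma ambient_mfderiv_standardAction (a b : ℤ) (z : Circle) (q : S6)
    (v : TangentSpace (𝓡 6) q) :
    ambient ⟨standardAction a b z q, mfderiv (𝓡 6) (𝓡 6) (standardAction a b z) q v⟩ =
      weightIsometry a b z (ambient ⟨q, v⟩) := by
  have h1 : (fun y : S6 => (standardAction a b z y : E7)) = fun y : S6 =>
      weightIsometry a b z (y : E7) :=
    funext (coe_standardAction a b z)
  rw [ambient_mfderiv ((contMDiff_standardAction_apply a b z q).mdifferentiableAt (by simp)), h1]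
  exact vectorDeriv_linearIsometry_comp _ (mdifferentiableAt_coe_sphere q) v

lemma contMDiff_coe_comp {c : Circle → S6} (hc : ContMDiff (𝓡 1) (𝓡 6) ∞ c) :
    ContMDiff (𝓡 1) 𝓘(ℝ, E7) ∞ fun z => (c z : E7) :=
  (contMDiff_coe_sphere (n := 6)).comp hc

lemma ambient_velocity {c : Circle → S6} (hc : ContMDiff (𝓡 1) (𝓡 6) ∞ c) (z : Circle) :
    ambient ⟨c z, velocity c z⟩ =
      vectorDeriv (𝓡 1) (fun w => (c w : E7)) z (circleField z) :=
  ambient_mfderiv ((hc z).mdifferentiableAt (by simp)) _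

/-- Right trivialisation of the derivative of a map on the circle. -/
noncomputable def derivAtOne (g : Circle → E7) : E7 :=
  vectorDeriv (𝓡 1) g 1 (EuclideanSpace.single 0 1 : EuclideanSpace ℝ (Fin 1))

lemma derivAtOne_comp_mul_left {g : Circle → E7} (hg : ContMDiff (𝓡 1) 𝓘(ℝ, E7) ∞ g)
    (z : Circle) :
    derivAtOne (fun w => g (z * w)) = vectorDeriv (𝓡 1) g z (circleField z) :=
  mfderiv_comp_apply_of_eq (I := 𝓡 1) (I' := 𝓡 1) (I'' := 𝓘(ℝ, E7)) (1 : Circle) (y := z)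
    ((hg z).mdifferentiableAt (by simp))
    ((contMDiff_circle_mul_left z 1).mdifferentiableAt (by simp)) (mul_one z) _

/-- Differentiate `c(zw) = z · c(w)` in `w` at `1`; the left-invariance of `circleField` makes the
velocity field of the orbit equivariant. -/
lemma ambient_velocity_eq_derivAtOne (a b : ℤ) (p : S6) (z : Circle) :
    ambient ⟨orbitCircle (standardAction a b) p z,
        velocity (orbitCircle (standardAction a b) p) z⟩ =
      weightIsometry a b z
        (derivAtOne fun w => ((orbitCircle (standardAction a b) p w : S6) : E7)) := by
  have hc := contMDiff_orbitCircle a b p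
  have hg := contMDiff_coe_comp hc
  have h1 : (fun w => ((orbitCircle (standardAction a b) p (z * w) : S6) : E7)) =
      fun w => weightIsometry a b z ((orbitCircle (standardAction a b) p w : S6) : E7) := by
    ext1 w
    rw [← coe_standardAction]
    simp only [orbitCircle, map_mul, Equiv.Perm.mul_apply]
  rw [ambient_velocity hc, ← derivAtOne_comp_mul_left hg z, h1]
  exact vectorDeriv_linearIsometry_comp _ ((hg 1).mdifferentiableAt (by simp)) _

lemma ambient_velocity_orbitCircle (a b : ℤ) (p : S6) (z : Circle) :
    ambient ⟨orbitCircle (standardAction a b) p z,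
        velocity (orbitCircle (standardAction a b) p) z⟩ =
      weightIsometry a b z (ambient ⟨orbitCircle (standardAction a b) p 1,
        velocity (orbitCircle (standardAction a b) p) 1⟩) := by
  rw [ambient_velocity_eq_derivAtOne, ambient_velocity_eq_derivAtOne a b p 1,
    weightIsometry_apply a b 1, weightMap_one]

/-- The velocity vector of the exponential parametrisation of the circle. -/
noncomputable def expVelocity (t : ℝ) : TangentSpace (𝓡 1) (Circle.exp t) :=
  mfderiv 𝓘(ℝ, ℝ) (𝓡 1) Circle.exp t (1 : ℝ)

lemma hasDerivAt_comp_circleExp {g : Circle → E7} (hg : ContMDiff (𝓡 1) 𝓘(ℝ, E7) ∞ g) (t : ℝ) :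
    HasDerivAt (fun x => g (Circle.exp x))
      (vectorDeriv (𝓡 1) g (Circle.exp t) (expVelocity t)) t := by
  have h1 : HasMFDerivAt 𝓘(ℝ, ℝ) (𝓡 1) Circle.exp t (mfderiv 𝓘(ℝ, ℝ) (𝓡 1) Circle.exp t) :=
    ((contMDiff_circleExp (m := 1) t).mdifferentiableAt one_ne_zero).hasMFDerivAt
  have h2 := ((hg (Circle.exp t)).mdifferentiableAt (by simp)).hasMFDerivAt
  obtain ⟨L, hL, hL1⟩ : ∃ L : ℝ →L[ℝ] E7, HasFDerivAt (fun x => g (Circle.exp x)) L t ∧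
      L 1 = vectorDeriv (𝓡 1) g (Circle.exp t) (expVelocity t) :=
    ⟨_, (h2.comp t h1).hasFDerivAt, rfl⟩
  rw [← hL1]
  exact hL.hasDerivAt

lemma ambient_zero (x : S6) : ambient ⟨x, 0⟩ = 0 := (ambientLinear x).map_zero

/-- A zero of the velocity spreads over the orbit by equivariance. The orbit map would be constant,
so `Circle.exp π ≠ 1` would fix `p`. -/
lemma velocity_orbitCircle_ne_zero {a b : ℤ} {p : S6} (hp : IsFreeOrbit (standardAction a b) p)
    (z : Circle) : velocity (orbitCircle (standardAction a b) p) z ≠ 0 := by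
  intro h0
  have hc := contMDiff_orbitCircle a b p
  have hg := contMDiff_coe_comp hc
  have hX : ∀ w, vectorDeriv (𝓡 1)
      (fun w => ((orbitCircle (standardAction a b) p w : S6) : E7)) w (circleField w) = 0 := by
    have h1 := ambient_velocity_eq_derivAtOne a b p z
    rw [h0, ambient_zero] at h1
    have h2 := (weightIsometry a b z).injective (h1.symm.trans (map_zero _).symm)
    intro w
    rw [← ambient_velocity hc, ambient_velocity_eq_derivAtOne, h2, map_zero]
  have hd : ∀ t, HasDerivAt (fun x => ((orbitCircle (standardAction a b) p (Circle.exp x) : S6) : E7))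
      0 t := by
    intro t
    have h1 := hasDerivAt_comp_circleExp hg t
    obtain ⟨r, hr⟩ := exists_eq_smul_of_ne_zero (circleField_ne_zero (Circle.exp t))
      (expVelocity t)
    rw [← hr, map_smul, hX, smul_zero] at h1
    exact h1
  have hconst := is_const_of_deriv_eq_zero (fun t => (hd t).differentiableAt)
    (fun t => (hd t).deriv) Real.pi 0
  have h1 : orbitCircle (standardAction a b) p (Circle.exp Real.pi) = p := by
    refine (Subtype.ext hconst).trans ?_
    simp [orbitCircle]
  exact Circle.exp_pi_ne_one (hp _ h1)

/-! ### Equivariant framings -/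

lemma finrank_tangentSpace (x : S6) : Module.finrank ℝ (TangentSpace (𝓡 6) x) = 5 + 1 := by
  change Module.finrank ℝ (EuclideanSpace ℝ (Fin 6)) = 5 + 1
  simp

instance (x : S6) : FiniteDimensional ℝ (TangentSpace (𝓡 6) x) :=
  inferInstanceAs (FiniteDimensional ℝ (EuclideanSpace ℝ (Fin 6)))

/-- Moves the velocity at time `1` to the tangent space at `p`, since the base point `1 · p` equals
`p` only propositionally. -/
lemma exists_ambient_eq_velocity (a b : ℤ) (p : S6) : ∃ X : TangentSpace (𝓡 6) p,
    ambient ⟨p, X⟩ = ambient ⟨orbitCircle (standardAction a b) p 1,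
        velocity (orbitCircle (standardAction a b) p) 1⟩ := by
  have h : ∀ q : S6, q = p → ∀ v : TangentSpace (𝓡 6) q,
      ∃ X : TangentSpace (𝓡 6) p, ambient ⟨p, X⟩ = ambient ⟨q, v⟩ := by
    rintro _ rfl v
    exact ⟨v, rfl⟩
  exact h _ (by simp [orbitCircle]) _

/-- Complete the velocity at `p` to a basis of the tangent space and push the five new vectors along
the orbit. The isometries preserve independence and carry the velocity at `p` to the velocity at `z
· p`. -/
theorem exists_isEquivariantFraming {a b : ℤ} {p : S6}
    (hp : IsFreeOrbit (standardAction a b) p) :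
    ∃ F : FieldsAlong 6 5 (orbitCircle (standardAction a b) p),
      IsEquivariantFraming (standardAction a b) p F := by
  obtain ⟨X, hX⟩ := exists_ambient_eq_velocity a b p
  have hX0 : X ≠ 0 := by
    rintro rfl
    rw [ambient_zero] at hX
    exact velocity_orbitCircle_ne_zero hp 1
      (LinearMap.ker_eq_bot'.1 (ker_ambientLinear _) _ hX.symm)
  obtain ⟨v, hv⟩ := exists_linearIndependent_cons (finrank_tangentSpace p) hX0
  refine ⟨fun t i => mfderiv (𝓡 6) (𝓡 6) (standardAction a b t) p (v i), ⟨fun i => ?_, ?_, ?_⟩,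
    v, fun _ _ => rfl⟩
  · exact continuous_tangentMap_family (I := 𝓡 1)
      ((contMDiff_standardAction a b).of_le (by simp)) continuous_id
      (continuous_const (y := (⟨p, v i⟩ : TangentBundle (𝓡 6) S6)))
  all_goals
    intro z
    have hli : LinearIndependent ℝ
        (Fin.cons (velocity (orbitCircle (standardAction a b) p) z) fun i =>
          mfderiv (𝓡 6) (𝓡 6) (standardAction a b z) p (v i) :
          Fin 6 → TangentSpace (𝓡 6) (orbitCircle (standardAction a b) p z)) := by
      have h1 : LinearIndependent ℝ fun i => weightIsometry a b z
          (ambientLinear p ((Fin.cons X v : Fin 6 → TangentSpace (𝓡 6) p) i)) :=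
        (hv.map' (ambientLinear p) (ker_ambientLinear p)).map'
          (weightIsometry a b z).toLinearMap
          (LinearMap.ker_eq_bot.2 (weightIsometry a b z).injective)
      refine LinearIndependent.of_comp (ambientLinear _) ?_
      have h2 : (ambientLinear (orbitCircle (standardAction a b) p z) ∘
          (Fin.cons (velocity (orbitCircle (standardAction a b) p) z) fun i =>
            mfderiv (𝓡 6) (𝓡 6) (standardAction a b z) p (v i) :
            Fin 6 → TangentSpace (𝓡 6) (orbitCircle (standardAction a b) p z))) =
          fun i => weightIsometry a b z
            (ambientLinear p ((Fin.cons X v : Fin 6 → TangentSpace (𝓡 6) p) i)) := by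
        funext i
        refine Fin.cases ?_ (fun j => ?_) i
        · exact (ambient_velocity_orbitCircle a b p z).trans
            (congrArg (weightIsometry a b z) hX.symm)
        · exact ambient_mfderiv_standardAction a b z p (v j)
      rw [h2]
      exact h1
    rw [tangentLine_eq_span]
  · exact (mkQ_basis_of_linearIndependent_cons (finrank_tangentSpace _) hli).1
  · exact (mkQ_basis_of_linearIndependent_cons (finrank_tangentSpace _) hli).2

open InnerProductSpace

/-! ### Loops of frames attached to framed circles -/

/-- Spin triviality is preserved along a homotopy of loops of frames of the sphere. -/
lemma SpinTrivial.of_sphereFrame_homotopy {W : ℝ × ℝ → Fin 6 → TangentBundle (𝓡 6) S6}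
    (hW : ∀ i, Continuous fun q => W q i)
    (hli : ∀ q, LinearIndependent ℝ (sphereFrame (W q)))
    (hper : ∀ s, W (s, 2 * Real.pi) = W (s, 0))
    (h : SpinTrivial fun t => gramSchmidtNormed ℝ (sphereFrame (W (0, t)))) :
    SpinTrivial fun t => gramSchmidtNormed ℝ (sphereFrame (W (1, t))) :=
  SpinTrivial.of_homotopy (f := fun q => gramSchmidtNormed ℝ (sphereFrame (W q)))
    (continuous_gramSchmidtNormed (continuous_sphereFrame hW) hli)
    (fun q => gramSchmidtNormed_orthonormal (hli q)) (fun s => by rw [hper]) h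

/-- The tangent vectors that consist of the velocity of a circle and a tuple of fields. -/
noncomputable def velocityCons (c : Circle → S6) (F : FieldsAlong 6 5 c) (z : Circle) :
    Fin 6 → TangentSpace (𝓡 6) (c z) :=
  Fin.cons (velocity c z) (F z)

lemma IsNormalFraming.linearIndependent_velocityCons {c : Circle → S6} {F : FieldsAlong 6 5 c}
    (hF : IsNormalFraming c F) {z : Circle} (hc : velocity c z ≠ 0) :
    LinearIndependent ℝ (velocityCons c F z) := by
  have h := hF.linearIndependent z
  rw [tangentLine_eq_span] at h
  exact linearIndependent_cons_of_mkQ hc h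

/-- The loop of orthonormal frames of a framed circle that is parametrised by `η`. -/
noncomputable def frameLoop (η : ℝ → Circle) (c : Circle → S6) (F : FieldsAlong 6 5 c) (t : ℝ) :
    Fin 7 → E7 :=
  gramSchmidtNormed ℝ (sphereFrame fun i => ⟨c (η t), velocityCons c F (η t) i⟩)

lemma SpinTrivial.of_framingHomotopic {η : ℝ → Circle} (hη : Continuous η)
    (hη0 : η (2 * Real.pi) = η 0) {c : Circle → S6} (hc : ContMDiff (𝓡 1) (𝓡 6) ∞ c)
    (hc0 : ∀ z, velocity c z ≠ 0) {F G : FieldsAlong 6 5 c} (hFG : FramingHomotopic c F G)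
    (h : SpinTrivial (frameLoop η c F)) : SpinTrivial (frameLoop η c G) := by
  obtain ⟨Γ, hΓ, hN, rfl, rfl⟩ := hFG
  -- Extends the homotopy to all real parameters, constantly outside `[0, 1]`.
  let pr : ℝ → unitInterval := Set.projIcc 0 1 zero_le_one
  have hpr : Continuous pr := continuous_projIcc
  have hp0 : pr 0 = 0 := Set.projIcc_left _
  have hp1 : pr 1 = 1 := Set.projIcc_right _
  have key := SpinTrivial.of_sphereFrame_homotopy
    (W := fun q i => ⟨c (η q.2), velocityCons c (Γ (pr q.1)) (η q.2) i⟩) (fun i => ?_)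
    (fun q => linearIndependent_sphereFrame ((hN _).linearIndependent_velocityCons (hc0 _)))
    (fun s => congrArg (fun z => fun i =>
      (⟨c z, velocityCons c (Γ (pr s)) z i⟩ : TangentBundle (𝓡 6) S6)) hη0)
  · simp only [hp0, hp1] at key
    exact key h
  · refine Fin.cases ?_ (fun j => ?_) i
    · exact (continuous_velocity hc).comp (hη.comp continuous_snd)
    · exact (hΓ j).comp ((hpr.comp continuous_fst).prodMk (hη.comp continuous_snd))

/-- The homotopy applies the derivative of `H.toDiffeo s` to the velocity and the framing; its
injectivity keeps the frames independent, and at `s = 0` it is the identity. -/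
lemma SpinTrivial.of_ambientIsotopy {η : ℝ → Circle} (hη : Continuous η)
    (hη0 : η (2 * Real.pi) = η 0) {c : Circle → S6} (hc : ContMDiff (𝓡 1) (𝓡 6) ∞ c)
    (hc0 : ∀ z, velocity c z ≠ 0) {G : FieldsAlong 6 5 c} (hG : IsNormalFraming c G)
    (H : AmbientIsotopy 6 S6) (h : SpinTrivial (frameLoop η c G)) :
    SpinTrivial fun t => gramSchmidtNormed ℝ (sphereFrame fun i =>
      tangentMap (𝓡 6) (𝓡 6) (H.toDiffeo 1) ⟨c (η t), velocityCons c G (η t) i⟩) := by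
  refine SpinTrivial.of_sphereFrame_homotopy (W := fun q i =>
      tangentMap (𝓡 6) (𝓡 6) (H.toDiffeo q.1) ⟨c (η q.2), velocityCons c G (η q.2) i⟩)
    (fun i => ?_) (fun q => ?_) (fun s => congrArg (fun z => fun i =>
      tangentMap (𝓡 6) (𝓡 6) (H.toDiffeo s) ⟨c z, velocityCons c G z i⟩) hη0) ?_
  · refine continuous_tangentMap_family (I := 𝓘(ℝ, ℝ)) (q := fun q : ℝ × ℝ => q.1)
      (v := fun q : ℝ × ℝ => (⟨c (η q.2), velocityCons c G (η q.2) i⟩ : TangentBundle (𝓡 6) S6))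
      (H.smooth.of_le (by simp)) continuous_fst ?_
    refine Fin.cases ?_ (fun j => ?_) i
    · exact (continuous_velocity hc).comp (hη.comp continuous_snd)
    · exact (hG.continuous j).comp (hη.comp continuous_snd)
  · refine linearIndependent_sphereFrame (x := H.toDiffeo q.1 (c (η q.2)))
      (w := fun i => mfderiv (𝓡 6) (𝓡 6) (H.toDiffeo q.1) (c (η q.2))
        (velocityCons c G (η q.2) i)) ?_
    exact (hG.linearIndependent_velocityCons (hc0 _)).map'
      ((H.toDiffeo q.1).mfderivToContinuousLinearEquiv (by simp) (c (η q.2))).toLinearMap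
      (LinearEquiv.ker _)
  · have h0 : ∀ v, tangentMap (𝓡 6) (𝓡 6) (H.toDiffeo 0) v = v := by
      intro v
      rw [H.zero, Diffeomorph.coe_refl, tangentMap_id]
      rfl
    simp only [h0]
    exact h

/-! ### The trivial framing of the coordinate circle -/

lemma contMDiff_coe_coordCircle :
    ContMDiff (𝓡 1) 𝓘(ℝ, E7) ∞ fun z => (coordCircle z : E7) := by
  have : Fact (Module.finrank ℝ ℂ = 1 + 1) := ⟨Complex.finrank_real_complex⟩
  have h : ContDiff ℝ ∞ fun w : ℂ => (!₂[w.re, w.im, 0, 0, 0, 0, 0] : E7) := by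
    have hre : ContDiff ℝ ∞ Complex.re := Complex.reCLM.contDiff
    have him : ContDiff ℝ ∞ Complex.im := Complex.imCLM.contDiff
    rw [contDiff_euclidean]
    intro i
    fin_cases i <;> simp <;> fun_prop
  have hc : ContMDiff (𝓡 1) 𝓘(ℝ, ℂ) ∞ fun z : Circle => (z : ℂ) :=
    (contMDiff_coe_sphere (E := ℂ) (n := 1)).comp contMDiff_id
  exact h.contMDiff.comp hc

lemma zero_ne_one_fin : (0 : Fin 7) ≠ 1 := by decide

lemma coe_coordCircle_exp (t : ℝ) :
    (coordCircle (Circle.exp t) : E7) =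
      planeRot zero_ne_one_fin t (EuclideanSpace.single 0 (1 : ℝ)) := by
  rw [planeRot_apply]
  ext i
  fin_cases i <;> simp [coordCircle, Circle.coe_exp, Complex.exp_ofReal_mul_I_re,
    Complex.exp_ofReal_mul_I_im]

lemma vectorDeriv_coordCircle (t : ℝ) :
    vectorDeriv (𝓡 1) (fun z => (coordCircle z : E7)) (Circle.exp t) (expVelocity t) =
      planeRot zero_ne_one_fin t (EuclideanSpace.single 1 (1 : ℝ)) := by
  have h1 := hasDerivAt_comp_circleExp contMDiff_coe_coordCircle t
  simp only [coe_coordCircle_exp, planeRot_apply] at h1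
  refine h1.unique ?_
  have h2 := (((Real.hasDerivAt_cos t).sub_const 1).smul_const
    (EuclideanSpace.single 0 (1 : ℝ) : E7)).add ((Real.hasDerivAt_sin t).smul_const
      (EuclideanSpace.single 1 (1 : ℝ) : E7))
  have h3 := h2.const_add (EuclideanSpace.single 0 (1 : ℝ) : E7)
  convert h3 using 1
  · ext1 x
    simp [add_assoc]
  · simp [planeRot_apply]
    module

/-- The constant vectors may be regarded as rotating along with position and velocity, so the
trivial framing gives the standard frame turned by `planeRot`. -/
lemma planeRot_natAdd (t : ℝ) (i : Fin 5) :
    planeRot zero_ne_one_fin t (EuclideanSpace.single (Fin.natAdd 2 i) (1 : ℝ)) =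
      EuclideanSpace.single (Fin.natAdd 2 i) (1 : ℝ) := by
  have h0 : (0 : Fin 7) ≠ Fin.natAdd 2 i := by revert i; decide
  have h1 : (1 : Fin 7) ≠ Fin.natAdd 2 i := by revert i; decide
  rw [planeRot_apply]
  simp [h0, h1]

lemma continuous_planeRot (v : E7) : Continuous fun t => planeRot zero_ne_one_fin t v := by
  simp only [planeRot_apply]
  fun_prop

lemma ambient_coordFraming (z : Circle) (i : Fin 5) :
    ambient ⟨coordCircle z, coordFraming z i⟩ = EuclideanSpace.single (Fin.natAdd 2 i) (1 : ℝ) :=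
  mfderiv_coe_coordFraming z i

/-- A diffeomorphism from a circle to the coordinate circle maps the velocity field to multiples
of the velocity field of the coordinate circle. -/
lemma exists_ambient_tangentMap_velocity {c : Circle → S6} (hc : ContMDiff (𝓡 1) (𝓡 6) ∞ c)
    (Φ : Diffeomorph (𝓡 6) (𝓡 6) S6 S6 ∞) (σ : Diffeomorph (𝓡 1) (𝓡 1) Circle Circle ∞)
    (h : ∀ z, Φ (c z) = coordCircle (σ z)) {z : Circle} {t : ℝ} (hz : σ z = Circle.exp t) :
    ∃ r : ℝ, ambient (tangentMap (𝓡 6) (𝓡 6) Φ ⟨c z, velocity c z⟩) =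
      r • planeRot zero_ne_one_fin t (EuclideanSpace.single 1 (1 : ℝ)) := by
  have hcz : MDifferentiableAt (𝓡 1) (𝓡 6) c z := (hc z).mdifferentiableAt (by simp)
  have hΦ : MDifferentiableAt (𝓡 6) (𝓡 6) Φ (c z) :=
    (Φ.contMDiff (c z)).mdifferentiableAt (by simp)
  have h1 : ambient (tangentMap (𝓡 6) (𝓡 6) Φ ⟨c z, velocity c z⟩) =
      vectorDeriv (𝓡 1) (fun w => (Φ (c w) : E7)) z (circleField z) := by
    rw [← ambient_mfderiv (g := fun w => Φ (c w)) (hΦ.comp z hcz)]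
    exact congrArg ambient
      (congrArg (fun u => (⟨Φ (c z), u⟩ : TangentBundle (𝓡 6) S6))
        (mfderiv_comp_apply (I := 𝓡 1) z hΦ hcz (circleField z)).symm)
  have h2 : (fun w => (Φ (c w) : E7)) = (fun y => (coordCircle y : E7)) ∘ σ := by
    ext1 w
    rw [h w]
    rfl
  have hv : expVelocity t ≠ 0 := by
    intro h0
    have h3 := vectorDeriv_coordCircle t
    rw [h0, map_zero] at h3
    have h4 := congrArg norm h3
    rw [LinearIsometry.norm_map] at h4
    simp at h4
  have h5 : vectorDeriv (𝓡 1) ((fun y => (coordCircle y : E7)) ∘ σ) z (circleField z) =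
      vectorDeriv (𝓡 1) (fun y => (coordCircle y : E7)) (Circle.exp t)
        (mfderiv (𝓡 1) (𝓡 1) σ z (circleField z)) :=
    mfderiv_comp_apply_of_eq (I := 𝓡 1) (I' := 𝓡 1) (I'' := 𝓘(ℝ, E7)) z
      ((contMDiff_coe_coordCircle (Circle.exp t)).mdifferentiableAt (by simp))
      ((σ.contMDiff z).mdifferentiableAt (by simp)) hz _
  -- The tangent space of the circle is a line; the factor `r` absorbs the speed and orientation of
  -- `σ`.
  obtain ⟨r, hr⟩ := exists_eq_smul_of_ne_zero hv
    (mfderiv (𝓡 1) (𝓡 1) σ z (circleField z) : TangentSpace (𝓡 1) (Circle.exp t))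
  refine ⟨r, ?_⟩
  rw [h1, h2, h5, ← vectorDeriv_coordCircle t, ← map_smul, hr]

/-- Loops of frames that rotate once in the first coordinate plane, with the second vector scaled
by a nowhere vanishing factor, are not spin trivial. -/
lemma not_spinTrivial_gramSchmidt_planeRot {d : ℝ → ℝ} (hd : Continuous d)
    (hd0 : ∀ t, d t ≠ 0) {f : ℝ → Fin 7 → E7}
    (hf : ∀ t i, f t i = planeRot zero_ne_one_fin t
      ((if i = 1 then d t else 1) • EuclideanSpace.single i (1 : ℝ))) :
    ¬ SpinTrivial fun t => gramSchmidtNormed ℝ (f t) := by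
  -- Gram–Schmidt retains only the sign of `d`, which is constant; what remains is one rotation of a
  -- fixed orthonormal frame.
  have hsign : ∀ t, |d t|⁻¹ * d t = |d 0|⁻¹ * d 0 := by
    intro t
    have hpos : 0 < d 0 * d t := by
      rcases le_total 0 t with ht | ht
      · exact mul_pos_of_continuousOn_of_ne_zero ht hd.continuousOn fun s _ => hd0 s
      · rw [mul_comm]
        exact mul_pos_of_continuousOn_of_ne_zero ht hd.continuousOn fun s _ => hd0 s
    rcases pos_and_pos_or_neg_and_neg_of_mul_pos hpos with ⟨h1, h2⟩ | ⟨h1, h2⟩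
    · rw [abs_of_pos h1, abs_of_pos h2, inv_mul_cancel₀ h1.ne', inv_mul_cancel₀ h2.ne']
    · rw [abs_of_neg h1, abs_of_neg h2, inv_neg, inv_neg, neg_mul, neg_mul,
        inv_mul_cancel₀ h1.ne, inv_mul_cancel₀ h2.ne]
  have hform : ∀ t i, gramSchmidtNormed ℝ (f t) i = planeRot zero_ne_one_fin t
      (gramSchmidtNormed ℝ (fun i => (if i = 1 then d 0 else 1) •
        (EuclideanSpace.single i (1 : ℝ) : E7)) i) := by
    intro t i
    have h1 : f t = fun i => planeRot zero_ne_one_fin t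
      ((if i = 1 then d t else 1) • EuclideanSpace.single i (1 : ℝ)) := funext (hf t)
    rw [h1, gramSchmidtNormed_comp_linearIsometry, gramSchmidtNormed_smul_single,
      gramSchmidtNormed_smul_single]
    congr 2
    split_ifs
    · exact hsign t
    · rfl
  refine not_spinTrivial_planeRot zero_ne_one_fin (gramSchmidtNormed_orthonormal ?_) hform
  have hb := (EuclideanSpace.basisFun (Fin 7) ℝ).orthonormal.linearIndependent
  have hu := hb.units_smul fun i : Fin 7 =>
    Units.mk0 (if i = 1 then d 0 else 1) (by split_ifs; exacts [hd0 0, one_ne_zero])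
  convert hu using 1
  ext1 i
  simp [Units.smul_def]

/-! ### The main theorem -/

/-- Every loop in the circle lifts to a path of angles. -/
lemma exists_continuous_angle {η : ℝ → Circle} (hη : Continuous η)
    (hη0 : η (2 * Real.pi) = η 0) : ∃ (h : ℝ → ℝ) (k : ℤ), Continuous h ∧
      (∀ t, Circle.exp (h t) = η t) ∧ h (2 * Real.pi) = h 0 + k * (2 * Real.pi) := by
  obtain ⟨h, ⟨-, hh⟩, -⟩ := Circle.isCoveringMap_exp.existsUnique_continuousMap_lifts
    (⟨η, hη⟩ : C(ℝ, Circle)) 0 (Complex.arg (η 0)) (Circle.exp_arg _)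
  have hh' : ∀ t, Circle.exp (h t) = η t := fun t => congrFun hh t
  obtain ⟨k, hk⟩ := Circle.exp_eq_exp.1 ((hh' (2 * Real.pi)).trans (hη0.trans (hh' 0).symm))
  exact ⟨h, k, h.continuous, hh', hk⟩

/-- Position, velocity and framing are all images under the action of fixed vectors at `p`, so after
Gram–Schmidt the loop is a fixed orthonormal frame moved by the weights. -/
lemma IsEquivariantFraming.spinTrivial {a b : ℤ} {p : S6}
    {F : FieldsAlong 6 5 (orbitCircle (standardAction a b) p)}
    (hF : IsEquivariantFraming (standardAction a b) p F) {η : ℝ → Circle} (hη : Continuous η)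
    (hη0 : η (2 * Real.pi) = η 0) :
    SpinTrivial (frameLoop η (orbitCircle (standardAction a b) p) F) := by
  obtain ⟨h, k, hh, hexp, hk⟩ := exists_continuous_angle hη hη0
  obtain ⟨v, hv⟩ := hF.equivariant
  obtain ⟨X, hX⟩ := exists_ambient_eq_velocity a b p
  refine spinTrivial_weightMap a b
    (g := gramSchmidtNormed ℝ (sphereFrame fun i =>
      ⟨p, (Fin.cons X v : Fin 6 → TangentSpace (𝓡 6) p) i⟩)) hh hk fun t i => ?_
  rw [hexp, ← weightIsometry_apply, ← gramSchmidtNormed_comp_linearIsometry, frameLoop]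
  congr 1
  funext i
  refine Fin.cases ?_ (fun j => Fin.cases ?_ (fun l => ?_) j) i
  · exact coe_standardAction a b (η t) p
  · exact (ambient_velocity_orbitCircle a b p (η t)).trans
      (congrArg (weightIsometry a b (η t)) hX.symm)
  · refine (congrArg ambient (congrArg (fun u =>
      (⟨orbitCircle (standardAction a b) p (η t), u⟩ : TangentBundle (𝓡 6) S6))
        (hv (η t) l))).trans ?_
    exact ambient_mfderiv_standardAction a b (η t) p (v l)

/-- A framing whose loops of frames are all spin trivial is not trivial. -/
theorem not_isTrivialFraming_of_spinTrivial {c : Circle → S6} (hc : ContMDiff (𝓡 1) (𝓡 6) ∞ c)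
    (hc0 : ∀ z, velocity c z ≠ 0) {F : FieldsAlong 6 5 c}
    (hF : ∀ η : ℝ → Circle, Continuous η → η (2 * Real.pi) = η 0 →
      SpinTrivial (frameLoop η c F)) : ¬ IsTrivialFraming c F := by
  rintro ⟨H, σ, G, hFG, hcirc, hframe⟩
  -- With this parametrisation the image traverses the coordinate circle by angle. As `σ` is
  -- arbitrary, spin triviality is needed for every loop `η`.
  set η : ℝ → Circle := fun t => σ.symm (Circle.exp t) with hηdef
  have hη : Continuous η := σ.symm.continuous.comp Circle.exp.continuous
  have hη0 : η (2 * Real.pi) = η 0 := by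
    simp only [hηdef, Circle.exp_two_pi, Circle.exp_zero]
  have hση : ∀ t, σ (η t) = Circle.exp t := fun t => σ.apply_symm_apply _
  have hG : IsNormalFraming c G := by
    obtain ⟨Γ, -, hN, -, rfl⟩ := hFG
    exact hN 1
  have hspin := SpinTrivial.of_ambientIsotopy hη hη0 hc hc0 hG H
    (SpinTrivial.of_framingHomotopic hη hη0 hc hc0 hFG (hF η hη hη0))
  set A : ℝ → E7 := fun t =>
    ambient (tangentMap (𝓡 6) (𝓡 6) (H.toDiffeo 1) ⟨c (η t), velocity c (η t)⟩) with hA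
  set e : ℝ → E7 := fun t => planeRot zero_ne_one_fin t (EuclideanSpace.single 1 (1 : ℝ)) with he
  -- The pushed velocity is a pointwise multiple of the unit vector `e t`; recovering the factor as
  -- an inner product makes it continuous in `t`.
  set d : ℝ → ℝ := fun t => inner ℝ (e t) (A t) with hd
  have hAc : Continuous A := continuous_ambient.comp
    ((((H.toDiffeo 1).contMDiff).continuous_tangentMap (by simp)).comp
      ((continuous_velocity hc).comp hη))
  have hdc : Continuous d := (continuous_planeRot _).inner hAc
  have hAd : ∀ t, A t = d t • e t := by
    intro t
    obtain ⟨r, hr⟩ := exists_ambient_tangentMap_velocity hc (H.toDiffeo 1) σ hcirc (hση t)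
    have h1 : A t = r • e t := hr
    have h2 : d t = r := by
      simp only [hd, h1, inner_smul_right, real_inner_self_eq_norm_sq, he,
        LinearIsometry.norm_map]
      simp
    rw [h1, h2]
  have hd0 : ∀ t, d t ≠ 0 := by
    intro t h0
    have h1 := hAd t
    rw [h0, zero_smul] at h1
    have h2 := LinearMap.ker_eq_bot'.1 (ker_ambientLinear _) _ h1
    exact hc0 (η t) (((H.toDiffeo 1).mfderivToContinuousLinearEquiv (by simp)
      (c (η t))).map_eq_zero_iff.1 h2)
  refine not_spinTrivial_gramSchmidt_planeRot hdc hd0 (fun t i => ?_) hspin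
  refine Fin.cases ?_ (fun j => Fin.cases ?_ (fun l => ?_) j) i
  · have h1 : (H.toDiffeo 1 (c (η t)) : E7) = coordCircle (Circle.exp t) := by
      rw [hcirc, hση]
    rw [if_neg (by decide), one_smul, ← coe_coordCircle_exp]
    exact h1
  · rw [if_pos (by decide), map_smul]
    exact hAd t
  · have h1 : ambient (tangentMap (𝓡 6) (𝓡 6) (H.toDiffeo 1) ⟨c (η t), G (η t) l⟩) =
        EuclideanSpace.single (Fin.natAdd 2 l) (1 : ℝ) := by
      rw [hframe, ambient_coordFraming]
    have h2 : ∀ l : Fin 5, l.succ.succ = Fin.natAdd 2 l := by decide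
    have h3 : ∀ l : Fin 5, (l.succ.succ : Fin 7) ≠ 1 := by decide
    rw [if_neg (h3 l), one_smul]
    refine Eq.trans ?_ ((planeRot_natAdd t l).symm.trans
      (congrArg (fun i => planeRot zero_ne_one_fin t (EuclideanSpace.single i (1 : ℝ)))
        (h2 l).symm))
    exact h1

end CircleFraming

theorem mainTheorem6 (a b : ℤ) (ha : a ≠ 0) (hb : b ≠ 0) (p : CircleFraming.S6)
    (hp : CircleFraming.IsFreeOrbit (CircleFraming.standardAction a b) p) :
    (∃ F : CircleFraming.FieldsAlong 6 5
        (CircleFraming.orbitCircle (CircleFraming.standardAction a b) p),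
      CircleFraming.IsEquivariantFraming (CircleFraming.standardAction a b) p F) ∧
    ∀ F : CircleFraming.FieldsAlong 6 5
        (CircleFraming.orbitCircle (CircleFraming.standardAction a b) p),
      CircleFraming.IsEquivariantFraming (CircleFraming.standardAction a b) p F →
        ¬ CircleFraming.IsTrivialFraming
          (CircleFraming.orbitCircle (CircleFraming.standardAction a b) p) F :=
  ⟨CircleFraming.exists_isEquivariantFraming hp, fun _ hF =>
    CircleFraming.not_isTrivialFraming_of_spinTrivial (CircleFraming.contMDiff_orbitCircle a b p)
      (CircleFraming.velocity_orbitCircle_ne_zero hp) fun _ hη hη0 => hF.spinTrivial hη hη0⟩
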